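/- Let $d\in\mathbb N$ and write $\mathbb R^{2d}=\mathbb R^d\times\mathbb R^d$ with the symplectic form $\sigma((x,\xi),(x',\xi'))=x'\cdot\xi-x\cdot\xi'$. For $m\in L^\infty(\mathbb R^{2d})$ and a Schwartz function $\Psi$ on $\mathbb R^{2d}$ let $$T_m(\Psi)(z)=\int_{\mathbb R^{2d}}m(\zeta)\,\mathcal F_\sigma(\Psi)(\zeta)\,e^{-2\pi i\sigma(z,\zeta)}\,d\zeta,\qquad \mathcal F_\sigma(\Psi)(\zeta)=\int_{\mathbb R^{2d}}\Psi(z)\,e^{-2\pi i\sigma(\zeta,z)}\,dz .$$ For $1\le p\le\infty$ let $\mathcal S^p$ be the Schatten class of bounded operators $T$ on $L^2(\mathbb R^d)$ whose sequence of singular values $(s_n(T))_n$ lies in $\ell^p$, with norm $\|T\|_{\mathcal S^p}=\|(s_n(T))_n\|_{\ell^p}$; $\mathcal S^\infty$ is the space of all bounded operators with the operator norm. For $z=(x,\xi)$ let $\rho(z)f(t)=e^{-\pi i x\cdot\xi}e^{2\pi i\xi\cdot t}f(t-x)$ on $L^2(\mathbb R^d)$, and for $T\in\mathcal S^1$ let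 $$\mathfrak T_m(T)=\int_{\mathbb R^{2d}}m(z)\,\mathcal F_W(T)(z)\,\rho(z)\,dz\quad\text{(weak integral)},\qquad \mathcal F_W(T)(z)=\operatorname{tr}(T\rho(z)^*).$$ For $1\le p,q\le\infty$ let $\mathcal M_{p,q}$ be the set of those $m\in L^\infty(\mathbb R^{2d})$ for which $T_m$ extends to a bounded linear operator $L^p(\mathbb R^{2d})\to L^q(\mathbb R^{2d})$, and $\mathfrak M_{p,q}$ the set of those $m\in L^\infty(\mathbb R^{2d})$ for which $\mathfrak T_m$ extends to a bounded linear operator $\mathcal S^p\to\mathcal S^q$. Let $\|m\|_{\mathcal M_{p,q}}$ and $\|m\|_{\mathfrak M_{p,q}}$ be the least operator norm of such an extension (it is unique if $p<\infty$), and $\infty$ if there is none. **Theorem.** For every compact set $\Omega\subseteq\mathbb R^{2d}$ there is a constant $C\ge 1$, depending only on $d$ and $\Omega$, such that for all $m\in L^\infty(\mathbb R^{2d})$ that vanish almost everywhere outside $\Omega$ and all $1\le p,q\le\infty$: $$m\in\mathcal M_{p,q}\iff m\in\mathfrak M_{p,q},\qquad\text{and}\qquad \frac1C\|m\|_{\mathfrak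 M_{p,q}}\le\|m\|_{\mathcal M_{p,q}}\le C\,\|m\|_{\mathfrak M_{p,q}} .$$ -/

import Mathlib

open MeasureTheory
open scoped ENNReal NNReal SchwartzMap

noncomputable section

/-! ### Singular values and Schatten classes -/

section Schatten

variable {H : Type*} [NormedAddCommGroup H] [InnerProductSpace ℂ H]

/-- The `n`-th singular value (`n = 0, 1, 2, …`) of a bounded operator `T` on a Hilbert space:
the distance in operator norm from `T` to the operators of rank at most `n`. -/
def singularNumber (T : H →L[ℂ] H) (n : ℕ) : ℝ :=
  Metric.infDist T {F : H →L[ℂ] H | (F : H →ₗ[ℂ] H).rank ≤ n}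

/-- The Schatten norm `‖T‖_{𝒮^p} = ‖(s_n(T))_n‖_{ℓ^p}`, with values in `[0, ∞]`. For `p = ∞` it is
`sup_n s_n(T) = s_0(T) = ‖T‖`. -/
def schattenNorm (p : ℝ≥0∞) (T : H →L[ℂ] H) : ℝ≥0∞ :=
  eLpNorm (singularNumber T) p Measure.count

lemma exists_singularNumber_lt (T : H →L[ℂ] H) (n : ℕ) {ε : ℝ} (hε : 0 < ε) :
    ∃ F : H →L[ℂ] H, (F : H →ₗ[ℂ] H).rank ≤ n ∧ ‖T - F‖ < singularNumber T n + ε := by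
  have hne : {F : H →L[ℂ] H | (F : H →ₗ[ℂ] H).rank ≤ n}.Nonempty :=
    ⟨0, by simp [LinearMap.rank_zero]⟩
  obtain ⟨F, hF, h⟩ := (Metric.infDist_lt_iff hne).1
    (lt_add_of_pos_right (singularNumber T n) hε)
  exact ⟨F, hF, by rwa [dist_eq_norm] at h⟩

lemma singularNumber_le (T F : H →L[ℂ] H) (n : ℕ) (hF : (F : H →ₗ[ℂ] H).rank ≤ n) :
    singularNumber T n ≤ ‖T - F‖ := by
  rw [← dist_eq_norm]
  exact Metric.infDist_le_dist_of_mem hF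

lemma singularNumber_nonneg (T : H →L[ℂ] H) (n : ℕ) : 0 ≤ singularNumber T n :=
  Metric.infDist_nonneg

lemma singularNumber_add_le (S T : H →L[ℂ] H) (n : ℕ) :
    singularNumber (S + T) n ≤ singularNumber S (n / 2) + singularNumber T (n / 2) := by
  refine le_of_forall_pos_le_add fun ε hε => ?_
  obtain ⟨F, hF, h1⟩ := exists_singularNumber_lt S (n / 2) (half_pos hε)
  obtain ⟨G, hG, h2⟩ := exists_singularNumber_lt T (n / 2) (half_pos hε)
  have hr : ((F + G : H →L[ℂ] H) : H →ₗ[ℂ] H).rank ≤ n := by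
    refine (LinearMap.rank_add_le (F : H →ₗ[ℂ] H) (G : H →ₗ[ℂ] H)).trans
      ((add_le_add hF hG).trans ?_)
    have h : n / 2 + n / 2 ≤ n := by omega
    exact_mod_cast h
  have h3 : ‖S + T - (F + G)‖ ≤ ‖S - F‖ + ‖T - G‖ := by
    rw [add_sub_add_comm]
    exact norm_add_le _ _
  have := singularNumber_le (S + T) (F + G) n hr
  linarith

lemma singularNumber_smul_le (c : ℂ) (T : H →L[ℂ] H) (n : ℕ) :
    singularNumber (c • T) n ≤ ‖c‖ * singularNumber T n := by
  refine le_of_forall_pos_le_add fun ε hε => ?_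
  have hc : 0 < ‖c‖ + 1 := by positivity
  obtain ⟨F, hF, h1⟩ := exists_singularNumber_lt T n (div_pos hε hc)
  have hr : ((c • F : H →L[ℂ] H) : H →ₗ[ℂ] H).rank ≤ n := by
    refine le_trans ?_ hF
    refine Submodule.rank_mono ?_
    rintro _ ⟨x, rfl⟩
    exact ⟨c • x, by simp⟩
  have h2 := singularNumber_le (c • T) (c • F) n hr
  rw [← smul_sub, norm_smul] at h2
  have h3 : ‖c‖ * ‖T - F‖ ≤ ‖c‖ * (singularNumber T n + ε / (‖c‖ + 1)) := by gcongr
  have h4 : ‖c‖ * (ε / (‖c‖ + 1)) ≤ ε := by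
    rw [mul_div_assoc', div_le_iff₀ hc]
    nlinarith
  linarith [mul_add ‖c‖ (singularNumber T n) (ε / (‖c‖ + 1))]

lemma memLp_count_half {p : ℝ≥0∞} {s : ℕ → ℝ} (hs : MemLp s p Measure.count) :
    MemLp (fun n => s (n / 2)) p Measure.count := by
  have hle : Measure.map (fun n : ℕ => n / 2) Measure.count ≤
      (2 : ℝ≥0∞) • (Measure.count : Measure ℕ) := by
    refine Measure.le_iff.2 fun t ht => ?_
    rw [Measure.map_apply (measurable_of_countable _) ht, Measure.smul_apply, smul_eq_mul]
    have hsub : (fun n : ℕ => n / 2) ⁻¹' t ⊆ (fun n => 2 * n) '' t ∪ (fun n => 2 * n + 1) '' t := by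
      intro n hn
      rcases Nat.even_or_odd' n with ⟨k, rfl | rfl⟩
      · refine Or.inl ⟨k, ?_, rfl⟩
        simpa using hn
      · refine Or.inr ⟨k, ?_, rfl⟩
        have h : (2 * k + 1) / 2 = k := by omega
        simpa [h] using hn
    refine (measure_mono hsub).trans ((measure_union_le _ _).trans ?_)
    rw [Measure.count_injective_image (fun a b h => by simpa using h),
      Measure.count_injective_image (fun a b h => by simpa using h), two_mul]
  exact MemLp.comp_of_map (hs.of_measure_le_smul (by simp) hle)
    (measurable_of_countable _).aemeasurable

/-- The Schatten class `𝒮^p` of bounded operators with `p`-summable singular values. For `p < ∞` its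
elements are compact; `𝒮^∞` consists of all bounded operators. -/
def schattenClass (H : Type*) [NormedAddCommGroup H] [InnerProductSpace ℂ H] (p : ℝ≥0∞) :
    Submodule ℂ (H →L[ℂ] H) where
  carrier := {T | schattenNorm p T < ∞}
  zero_mem' := by
    have h : singularNumber (0 : H →L[ℂ] H) = 0 := by
      funext n
      refine le_antisymm ?_ (singularNumber_nonneg _ _)
      simpa using singularNumber_le (0 : H →L[ℂ] H) 0 n (by simp [LinearMap.rank_zero])
    simp [schattenNorm, h]
  add_mem' := by
    intro S T hS hT
    have aux : ∀ s : ℕ → ℝ, AEStronglyMeasurable s Measure.count := fun s =>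
      (measurable_of_countable s).aestronglyMeasurable
    have h1 : MemLp (singularNumber S) p Measure.count := ⟨aux _, hS⟩
    have h2 : MemLp (singularNumber T) p Measure.count := ⟨aux _, hT⟩
    refine (((memLp_count_half h1).add (memLp_count_half h2)).of_le (aux _)
      (Filter.Eventually.of_forall fun n => ?_)).2
    rw [Real.norm_of_nonneg (singularNumber_nonneg _ _)]
    exact (singularNumber_add_le S T n).trans (le_abs_self _)
  smul_mem' := by
    intro c T hT
    have aux : ∀ s : ℕ → ℝ, AEStronglyMeasurable s Measure.count := fun s =>
      (measurable_of_countable s).aestronglyMeasurable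
    have h1 : MemLp (singularNumber T) p Measure.count := ⟨aux _, hT⟩
    refine (MemLp.of_le_mul (c := ‖c‖) h1 (aux _) (Filter.Eventually.of_forall fun n => ?_)).2
    rw [Real.norm_of_nonneg (singularNumber_nonneg _ _),
      Real.norm_of_nonneg (singularNumber_nonneg _ _)]
    exact singularNumber_smul_le c T n

/-- The trace `tr T = ∑_i ⟨T e_i, e_i⟩` of a trace class operator, computed in some orthonormal
basis `(e_i)`; for `T ∈ 𝒮^1` the sum converges absolutely and does not depend on the basis. -/
def operatorTrace {H : Type*} [NormedAddCommGroup H] [InnerProductSpace ℂ H] [CompleteSpace H]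
    (T : H →L[ℂ] H) : ℂ :=
  ∑' i : (exists_hilbertBasis ℂ H).choose,
    inner ℂ ((exists_hilbertBasis ℂ H).choose_spec.choose i)
      (T ((exists_hilbertBasis ℂ H).choose_spec.choose i))

end Schatten

/-! ### Phase space and the symmetric time-frequency shifts -/

/-- Phase space `ℝ^{2d} = ℝ^d × ℝ^d`, with points `z = (x, ξ)` and Lebesgue measure `volume`. -/
abbrev PhaseSpace (d : ℕ) : Type := EuclideanSpace ℝ (Fin d) × EuclideanSpace ℝ (Fin d)

instance {d : ℕ} : (volume : Measure (PhaseSpace d)).IsAddHaarMeasure :=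
  inferInstanceAs (((volume : Measure (EuclideanSpace ℝ (Fin d))).prod volume).IsAddHaarMeasure)

/-- The Hilbert space `L^2(ℝ^d)`. -/
abbrev L2Space (d : ℕ) : Type := Lp ℂ 2 (volume : Measure (EuclideanSpace ℝ (Fin d)))

/-- The standard symplectic form `σ((x, ξ), (x', ξ')) = x' · ξ - x · ξ'`. -/
def symplecticForm {d : ℕ} (z w : PhaseSpace d) : ℝ :=
  inner ℝ w.1 z.2 - inner ℝ z.1 w.2

/-- The function `ρ(x, ξ) f(t) = e^{-π i x·ξ} e^{2π i ξ·t} f(t - x)`. -/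
def shiftFun {d : ℕ} (z : PhaseSpace d) (f : EuclideanSpace ℝ (Fin d) → ℂ)
    (t : EuclideanSpace ℝ (Fin d)) : ℂ :=
  Complex.exp (-(Real.pi * Complex.I * (inner ℝ z.1 z.2 : ℝ))) *
    Complex.exp (2 * Real.pi * Complex.I * (inner ℝ z.2 t : ℝ)) * f (t - z.1)

lemma norm_shiftFun {d : ℕ} (z : PhaseSpace d) (f : EuclideanSpace ℝ (Fin d) → ℂ)
    (t : EuclideanSpace ℝ (Fin d)) : ‖shiftFun z f t‖ = ‖f (t - z.1)‖ := by
  simp [shiftFun, Complex.norm_exp]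

lemma measurePreserving_shift {d : ℕ} (z : PhaseSpace d) :
    MeasurePreserving (fun t : EuclideanSpace ℝ (Fin d) => t - z.1) volume volume :=
  measurePreserving_sub_right volume z.1

lemma memLp_shiftFun {d : ℕ} (z : PhaseSpace d) (f : L2Space d) :
    MemLp (shiftFun z f) 2 volume := by
  have h := (Lp.memLp f).comp_measurePreserving (measurePreserving_shift z)
  refine h.of_le ?_ (Filter.Eventually.of_forall fun t => (norm_shiftFun z f t).le)
  refine AEStronglyMeasurable.mul (Continuous.aestronglyMeasurable ?_) h.1
  fun_prop

/-- The symmetric time-frequency shift `ρ(z)` as a linear isometry of `L^2(ℝ^d)`. -/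
def timeFreqShiftₗᵢ {d : ℕ} (z : PhaseSpace d) : L2Space d →ₗᵢ[ℂ] L2Space d where
  toFun f := (memLp_shiftFun z f).toLp (shiftFun z f)
  map_add' f g := by
    rw [← MemLp.toLp_add, MemLp.toLp_eq_toLp_iff]
    filter_upwards [(measurePreserving_shift z).quasiMeasurePreserving.ae (Lp.coeFn_add f g)]
      with t ht
    simp only [shiftFun, Pi.add_apply, ht]
    ring
  map_smul' c f := by
    rw [RingHom.id_apply, ← MemLp.toLp_const_smul, MemLp.toLp_eq_toLp_iff]
    filter_upwards [(measurePreserving_shift z).quasiMeasurePreserving.ae (Lp.coeFn_smul c f)]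
      with t ht
    simp only [shiftFun, Pi.smul_apply, ht, smul_eq_mul]
    ring
  norm_map' f := by
    change ‖(memLp_shiftFun z f).toLp (shiftFun z f)‖ = ‖f‖
    rw [Lp.norm_toLp, Lp.norm_def,
      ← eLpNorm_comp_measurePreserving (Lp.aestronglyMeasurable f) (measurePreserving_shift z)]
    congr 1
    exact eLpNorm_congr_norm_ae (Filter.Eventually.of_forall fun t => norm_shiftFun z f t)

/-- The symmetric time-frequency shift `ρ(z)` as a bounded operator on `L^2(ℝ^d)`. -/
def timeFreqShift {d : ℕ} (z : PhaseSpace d) : L2Space d →L[ℂ] L2Space d :=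
  (timeFreqShiftₗᵢ z).toContinuousLinearMap

/-! ### Classical symplectic Fourier multipliers -/

/-- The symplectic Fourier transform `ℱ_σ(Ψ)(ζ) = ∫ Ψ(z) e^{-2π i σ(ζ, z)} dz`. -/
def symplecticFourier {d : ℕ} (Ψ : PhaseSpace d → ℂ) (ζ : PhaseSpace d) : ℂ :=
  ∫ z, Ψ z * Complex.exp (-(2 * Real.pi * Complex.I * (symplecticForm ζ z : ℝ)))

/-- `T_m(Ψ)(z) = ∫ m(ζ) ℱ_σ(Ψ)(ζ) e^{-2π i σ(z, ζ)} dζ` for a Schwartz function `Ψ`. -/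
def classicalMultiplierOp {d : ℕ} (m : PhaseSpace d → ℂ) (Ψ : 𝓢(PhaseSpace d, ℂ))
    (z : PhaseSpace d) : ℂ :=
  ∫ ζ, m ζ * symplecticFourier Ψ ζ *
    Complex.exp (-(2 * Real.pi * Complex.I * (symplecticForm z ζ : ℝ)))

/-- The bounded operator `A : L^p → L^q` extends `T_m`, i.e. agrees with it on Schwartz functions. -/
def ExtendsClassical {d : ℕ} (p q : ℝ≥0∞) [Fact (1 ≤ p)] [Fact (1 ≤ q)] (m : PhaseSpace d → ℂ)
    (A : Lp ℂ p (volume : Measure (PhaseSpace d)) →L[ℂ]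
      Lp ℂ q (volume : Measure (PhaseSpace d))) : Prop :=
  ∀ Ψ : 𝓢(PhaseSpace d, ℂ), A (Ψ.toLp p volume) =ᵐ[volume] classicalMultiplierOp m Ψ

/-- `m ∈ 𝓜_{p,q}`: `m ∈ L^∞` and `T_m` extends to a bounded linear operator `L^p → L^q`. -/
def IsClassicalMultiplier {d : ℕ} (p q : ℝ≥0∞) [Fact (1 ≤ p)] [Fact (1 ≤ q)]
    (m : PhaseSpace d → ℂ) : Prop :=
  MemLp m ∞ volume ∧
    ∃ A : Lp ℂ p (volume : Measure (PhaseSpace d)) →L[ℂ] Lp ℂ q (volume : Measure (PhaseSpace d)),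
      ExtendsClassical p q m A

/-- The multiplier norm `‖m‖_{𝓜_{p,q}}`: the least operator norm of a bounded extension of `T_m`
(the extension is unique if `p < ∞`), and `∞` if there is none. -/
def classicalMultiplierNorm {d : ℕ} (p q : ℝ≥0∞) [Fact (1 ≤ p)] [Fact (1 ≤ q)]
    (m : PhaseSpace d → ℂ) : ℝ≥0∞ :=
  ⨅ (A : Lp ℂ p (volume : Measure (PhaseSpace d)) →L[ℂ]
      Lp ℂ q (volume : Measure (PhaseSpace d))) (_ : ExtendsClassical p q m A), ‖A‖ₑ

/-! ### Fourier–Wigner multipliers -/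

/-- The Fourier–Wigner transform `ℱ_W(T)(z) = tr(T ρ(z)*)` of a trace class operator. -/
def fourierWigner {d : ℕ} (T : L2Space d →L[ℂ] L2Space d) (z : PhaseSpace d) : ℂ :=
  operatorTrace (T ∘L ContinuousLinearMap.adjoint (timeFreqShift z))

/-- The bounded operator `B` is the weak integral `∫ G(z) ρ(z) dz`: for all `f, g ∈ L^2(ℝ^d)` one
has `⟨B f, g⟩ = ∫ G(z) ⟨ρ(z) f, g⟩ dz` with an absolutely convergent integral. -/
def IsWeakShiftIntegral {d : ℕ} (G : PhaseSpace d → ℂ) (B : L2Space d →L[ℂ] L2Space d) : Prop :=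
  ∀ f g : L2Space d,
    Integrable (fun z => G z * inner ℂ g (timeFreqShift z f)) volume ∧
      inner ℂ g (B f) = ∫ z, G z * inner ℂ g (timeFreqShift z f)

/-- The linear map `A : 𝒮^p → 𝒮^q` extends the Fourier–Wigner multiplier
`𝔗_m(T) = ∫ m(z) ℱ_W(T)(z) ρ(z) dz`, `T ∈ 𝒮^1`. -/
def ExtendsFourierWigner {d : ℕ} (p q : ℝ≥0∞) (m : PhaseSpace d → ℂ)
    (A : schattenClass (L2Space d) p →ₗ[ℂ] schattenClass (L2Space d) q) : Prop :=
  ∀ T : schattenClass (L2Space d) p, (T : L2Space d →L[ℂ] L2Space d) ∈ schattenClass (L2Space d) 1 →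
    IsWeakShiftIntegral (fun z => m z * fourierWigner (T : L2Space d →L[ℂ] L2Space d) z)
      (A T : L2Space d →L[ℂ] L2Space d)

/-- The linear map `A : 𝒮^p → 𝒮^q` is bounded with constant `C`. -/
def IsSchattenBound {d : ℕ} {p q : ℝ≥0∞}
    (A : schattenClass (L2Space d) p →ₗ[ℂ] schattenClass (L2Space d) q) (C : ℝ≥0) : Prop :=
  ∀ T : schattenClass (L2Space d) p,
    schattenNorm q (A T : L2Space d →L[ℂ] L2Space d) ≤
      C * schattenNorm p (T : L2Space d →L[ℂ] L2Space d)

/-- `m ∈ 𝔐_{p,q}`: `m ∈ L^∞` and `𝔗_m` extends to a bounded linear operator `𝒮^p → 𝒮^q`. -/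
def IsFourierWignerMultiplier {d : ℕ} (p q : ℝ≥0∞) (m : PhaseSpace d → ℂ) : Prop :=
  MemLp m ∞ volume ∧
    ∃ A : schattenClass (L2Space d) p →ₗ[ℂ] schattenClass (L2Space d) q,
      ExtendsFourierWigner p q m A ∧ ∃ C : ℝ≥0, IsSchattenBound A C

/-- The multiplier norm `‖m‖_{𝔐_{p,q}}`: the least operator norm `𝒮^p → 𝒮^q` of a bounded extension
of `𝔗_m` (the extension is unique if `p < ∞`), and `∞` if there is none. -/
def fourierWignerMultiplierNorm {d : ℕ} (p q : ℝ≥0∞) (m : PhaseSpace d → ℂ) : ℝ≥0∞ :=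
  ⨅ (A : schattenClass (L2Space d) p →ₗ[ℂ] schattenClass (L2Space d) q) (C : ℝ≥0)
    (_ : ExtendsFourierWigner p q m A ∧ IsSchattenBound A C), (C : ℝ≥0∞)

end

/-! ### A weighted power mean inequality -/

/-! Let `φ_z = ρ(z)φ` be the Gaussian coherent states. Two maps link functions and operators: the
lower symbol `T ↦ ⟨φ_z, T φ_z⟩`, bounded from `𝒮^p` to `L^p`, and the localization map `F ↦ ∫ F(z)
φ_z ⊗ φ_z dz`, bounded from `L^q` to `𝒮^q`. The bounds do not depend on the exponents
(`IsCoherentFamily.eLpNorm_lowerSymbol_le`, `IsCoherentFamily.schattenNorm_localizationOp_le`). Both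
are proved without interpolation: the kernel weights have total mass at most one in each variable
separately, so Jensen's inequality in one variable followed by summation in the other treats every
finite exponent.

On the Fourier side both maps are multiplication by the positive function `G(w) = e^{-π|w|²/2}`, the
ambiguity function of the Gaussian: `ℱ_σ(lower symbol of T) = G · ℱ_W(T)`
(`symplecticFourier_lowerSymbol`) and `ℱ_W(localization operator of F) = G · ℱ_σ(F)`
(`fourierWigner_localizationOp`). Both rest on Moyal's identity in the form
`integral_symplecticChar_mul_inner`. Sandwiching a multiplier with symbol `m` between the two maps
therefore produces the multiplier of the other kind with symbol `m G²`.

Compactness of `Ω` undoes the factor `G²`. There is a Schwartz function `b` with `b G² = 1` on `Ω`,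
and multiplication by `b` on the Fourier side is convolution with `a = ℱ_σ(b)`, which by Young's
inequality is bounded on every `L^p` with norm at most `‖a‖₁`. Inserting this convolution next to
the lower symbol recovers `m` itself, in both directions, with constant `4‖a‖₁`, which involves
neither `m` nor `p, q`.

The remaining work is to check that the composed operators really extend the multipliers, also at `p
= ∞` where an extension is not determined by its values on a dense subspace. Operators to classical
functions is direct, since the localization operator of a Schwartz function is trace class.
Conversely, the smoothed lower symbol of a trace class operator need not be Schwartz, but it is an
`L^p` limit of Schwartz functions even for `p = ∞` (`ExtendsClassical.apply_phaseConv`). -/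

/-- Jensen's inequality for a weight of mass at most one: Hölder applied to `f w = (f w^{1/p}) ·
w^{1/q}`. Together with its discrete form it replaces interpolation in the Schatten and Young
estimates. -/
theorem lintegral_mul_rpow_le {α : Type*} [MeasurableSpace α] {μ : Measure α} {p : ℝ} (hp : 1 ≤ p)
    {f w : α → ℝ≥0∞} (hf : AEMeasurable f μ) (hw : AEMeasurable w μ) (h : ∫⁻ a, w a ∂μ ≤ 1) :
    (∫⁻ a, f a * w a ∂μ) ^ p ≤ ∫⁻ a, f a ^ p * w a ∂μ := by
  rcases hp.eq_or_lt with rfl | hp1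
  · simp
  have hp0 : 0 < p := one_pos.trans hp1
  have hpq : p.HolderConjugate (Real.conjExponent p) := Real.HolderConjugate.conjExponent hp1
  set q := Real.conjExponent p
  have hq0 : 0 < q := hpq.symm.pos
  have h1 := ENNReal.lintegral_mul_le_Lp_mul_Lq μ hpq (f := fun a => f a * w a ^ (1 / p))
    (g := fun a => w a ^ (1 / q)) (hf.mul (hw.pow_const _)) (hw.pow_const _)
  have h2 : ∀ a, ((fun a => f a * w a ^ (1 / p)) * fun a => w a ^ (1 / q)) a = f a * w a := by
    intro a
    simp only [Pi.mul_apply, mul_assoc]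
    rw [← ENNReal.rpow_add_of_nonneg _ _ (by positivity) (by positivity), one_div, one_div,
      hpq.inv_add_inv_eq_one, ENNReal.rpow_one]
  have h3 : ∀ a, (f a * w a ^ (1 / p)) ^ p = f a ^ p * w a := by
    intro a
    rw [ENNReal.mul_rpow_of_nonneg _ _ hp0.le, ← ENNReal.rpow_mul, one_div_mul_cancel hp0.ne',
      ENNReal.rpow_one]
  have h4 : ∀ a, (w a ^ (1 / q)) ^ q = w a := by
    intro a
    rw [← ENNReal.rpow_mul, one_div_mul_cancel hq0.ne', ENNReal.rpow_one]
  simp only [h2, h3, h4] at h1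
  calc (∫⁻ a, f a * w a ∂μ) ^ p ≤ ((∫⁻ a, f a ^ p * w a ∂μ) ^ (1 / p) * 1) ^ p := by
        gcongr
        refine h1.trans ?_
        gcongr
        exact ENNReal.rpow_le_one h (by positivity)
    _ = ∫⁻ a, f a ^ p * w a ∂μ := by
        rw [mul_one, ← ENNReal.rpow_mul, one_div_mul_cancel hp0.ne', ENNReal.rpow_one]

theorem tsum_mul_rpow_le {ι : Type*} {p : ℝ} (hp : 1 ≤ p) (f w : ι → ℝ≥0∞) (h : ∑' i, w i ≤ 1) :
    (∑' i, f i * w i) ^ p ≤ ∑' i, f i ^ p * w i := by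
  let _ : MeasurableSpace ι := ⊤
  simpa only [lintegral_count] using lintegral_mul_rpow_le (μ := Measure.count) hp (f := f) (w := w)
    (measurable_from_top).aemeasurable (measurable_from_top).aemeasurable
    (by rwa [lintegral_count])

theorem Real.enorm_le_enorm_of_le {x y : ℝ} (hx : 0 ≤ x) (h : x ≤ y) : ‖x‖ₑ ≤ ‖y‖ₑ := by
  rw [Real.enorm_of_nonneg hx, Real.enorm_of_nonneg (hx.trans h)]
  exact ENNReal.ofReal_le_ofReal h

/-! ### Singular numbers -/

section Singular

variable {H : Type*} [NormedAddCommGroup H] [InnerProductSpace ℂ H]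

theorem singularNumber_antitone (T : H →L[ℂ] H) : Antitone (singularNumber T) := by
  intro m n hmn
  refine le_of_forall_pos_le_add fun ε hε => ?_
  obtain ⟨F, hF, h⟩ := exists_singularNumber_lt T m hε
  exact (singularNumber_le T F n (hF.trans (by exact_mod_cast hmn))).trans h.le

theorem singularNumber_zero_eq_norm (T : H →L[ℂ] H) : singularNumber T 0 = ‖T‖ := by
  refine le_antisymm (by simpa using singularNumber_le T 0 0 (by simp [LinearMap.rank_zero])) ?_
  refine le_of_forall_pos_le_add fun ε hε => ?_
  obtain ⟨F, hF, h⟩ := exists_singularNumber_lt T 0 hε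
  have hF0 : F = 0 := by
    have h1 : (F : H →ₗ[ℂ] H).rank = 0 := le_antisymm (by simpa using hF) zero_le
    ext x
    have h2 := LinearMap.range_eq_bot.1 (Submodule.rank_eq_zero.1 h1)
    simpa using congrArg (fun L : H →ₗ[ℂ] H => L x) h2
  simpa [hF0] using h.le

theorem enorm_le_schattenNorm {p : ℝ≥0∞} (hp : p ≠ 0) (T : H →L[ℂ] H) :
    ‖T‖ₑ ≤ schattenNorm p T := by
  have h0 : ‖T‖ₑ = ‖singularNumber T 0‖ₑ := by
    rw [singularNumber_zero_eq_norm, enorm_norm]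
  rw [h0, schattenNorm]
  by_cases hpt : p = ∞
  · subst hpt
    rw [eLpNorm_exponent_top, eLpNormEssSup_count]
    exact le_iSup (fun n => ‖singularNumber T n‖ₑ) 0
  · have hp' : 0 < p.toReal := ENNReal.toReal_pos hp hpt
    rw [eLpNorm_eq_lintegral_rpow_enorm_toReal hp hpt, lintegral_count,
      ← ENNReal.rpow_le_rpow_iff hp', ← ENNReal.rpow_mul, one_div_mul_cancel hp'.ne',
      ENNReal.rpow_one]
    exact ENNReal.le_tsum (f := fun n => ‖singularNumber T n‖ₑ ^ p.toReal) 0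

theorem schattenNorm_top_le (T : H →L[ℂ] H) : schattenNorm ∞ T ≤ ‖T‖ₑ := by
  rw [schattenNorm, eLpNorm_exponent_top, eLpNormEssSup_count]
  refine iSup_le fun n => ?_
  rw [← enorm_norm T]
  refine Real.enorm_le_enorm_of_le (singularNumber_nonneg _ _) ?_
  rw [← singularNumber_zero_eq_norm]
  exact singularNumber_antitone T (Nat.zero_le n)

theorem norm_sum_smul_sq {ι : Type*} {w : ι → H} (hw : Pairwise fun i j => inner ℂ (w i) (w j) = 0)
    (s : Finset ι) (c : ι → ℂ) :
    ‖∑ i ∈ s, c i • w i‖ ^ 2 = ∑ i ∈ s, ‖c i‖ ^ 2 * ‖w i‖ ^ 2 := by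
  classical
  induction s using Finset.induction_on with
  | empty => simp
  | insert a s ha ih =>
    rw [Finset.sum_insert ha, Finset.sum_insert ha, ← ih, sq, sq ‖∑ i ∈ s, c i • w i‖,
      norm_add_sq_eq_norm_sq_add_norm_sq_of_inner_eq_zero (𝕜 := ℂ), norm_smul]
    · ring
    · rw [inner_sum]
      refine Finset.sum_eq_zero fun i hi => ?_
      rw [inner_smul_left, inner_smul_right, hw (by rintro rfl; exact ha hi)]
      simp

/-- More than `n` of the vectors `v i` span a space on which an operator `F` of rank at most `n` has
a nonzero kernel vector, while `T` is bounded below by `r` there because it keeps the `v i`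
orthogonal. -/
theorem le_singularNumber {ι : Type*} (T : H →L[ℂ] H) {v : ι → H} (hv : Orthonormal ℂ v)
    (hT : Pairwise fun i j => inner ℂ (T (v i)) (T (v j)) = 0) {s : Finset ι} {n : ℕ}
    (hn : n < s.card) {r : ℝ} (hr : 0 ≤ r) (hs : ∀ i ∈ s, r ≤ ‖T (v i)‖) :
    r ≤ singularNumber T n := by
  classical
  have hne : {F : H →L[ℂ] H | (F : H →ₗ[ℂ] H).rank ≤ n}.Nonempty :=
    ⟨0, by simp [LinearMap.rank_zero]⟩
  refine (Metric.le_infDist hne).2 fun F hF => ?_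
  let L : (s → ℂ) →ₗ[ℂ] H := ∑ i : s, (LinearMap.proj i : (s → ℂ) →ₗ[ℂ] ℂ).smulRight (v i)
  have hL : ∀ c, L c = ∑ i : s, c i • v i := fun c => by simp [L]
  let K : (s → ℂ) →ₗ[ℂ] (F : H →ₗ[ℂ] H).range :=
    ((F : H →ₗ[ℂ] H).rangeRestrict) ∘ₗ L
  have hfin : Module.rank ℂ (F : H →ₗ[ℂ] H).range ≤ n := hF
  have : FiniteDimensional ℂ (F : H →ₗ[ℂ] H).range := by
    refine Module.rank_lt_aleph0_iff.1 (hfin.trans_lt Cardinal.natCast_lt_aleph0)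
  have hfr : Module.finrank ℂ (F : H →ₗ[ℂ] H).range ≤ n := Module.finrank_le_of_rank_le hfin
  -- `K` is `F` restricted to combinations of the chosen vectors; it maps `s.card > n` dimensions
  -- into at most `n`.
  have hker : K.ker ≠ ⊥ := LinearMap.ker_ne_bot_of_finrank_lt (by
    rw [Module.finrank_fintype_fun_eq_card, Fintype.card_coe]; omega)
  obtain ⟨c, hc, hc0⟩ := (Submodule.ne_bot_iff _).1 hker
  have hFL : F (L c) = 0 := by
    have := congrArg Subtype.val (LinearMap.mem_ker.1 hc)
    simpa [K] using this
  have e1 : ‖L c‖ ^ 2 = ∑ i : s, ‖c i‖ ^ 2 := by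
    rw [hL, norm_sum_smul_sq (w := fun i : s => v i)]
    · simp [hv.1]
    · intro i j hij
      exact hv.2 fun h => hij (Subtype.ext h)
  have e2 : ‖T (L c)‖ ^ 2 = ∑ i : s, ‖c i‖ ^ 2 * ‖T (v i)‖ ^ 2 := by
    rw [hL, map_sum]
    simp only [map_smul]
    rw [norm_sum_smul_sq (w := fun i : s => T (v i))]
    intro i j hij
    exact hT fun h => hij (Subtype.ext h)
  have hpos : 0 < ‖L c‖ := by
    have : ‖L c‖ ^ 2 ≠ 0 := by
      rw [e1]
      intro h
      rw [Finset.sum_eq_zero_iff_of_nonneg (fun i _ => by positivity)] at h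
      exact hc0 (funext fun i => by simpa using h i (Finset.mem_univ i))
    exact lt_of_le_of_ne (norm_nonneg _) fun h => this (by rw [← h]; simp)
  have h3 : r * ‖L c‖ ≤ ‖T (L c)‖ := by
    refine le_of_sq_le_sq ?_ (norm_nonneg _)
    rw [mul_pow, e1, e2, Finset.mul_sum]
    refine Finset.sum_le_sum fun i _ => ?_
    rw [mul_comm]
    have := hs i i.2
    gcongr
  have h4 : ‖T (L c)‖ ≤ ‖T - F‖ * ‖L c‖ := by
    have := (T - F).le_opNorm (L c)
    simpa [hFL] using this
  rw [dist_eq_norm]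
  exact le_of_mul_le_mul_right (h3.trans h4) hpos

theorem sum_le_sum_singularNumber {ι : Type*} (T : H →L[ℂ] H) {v : ι → H} (hv : Orthonormal ℂ v)
    (hT : Pairwise fun i j => inner ℂ (T (v i)) (T (v j)) = 0) {p : ℝ} (hp : 0 < p) (s : Finset ι) :
    ∑ i ∈ s, ‖T (v i)‖ₑ ^ p ≤ ∑ n ∈ Finset.range s.card, ‖singularNumber T n‖ₑ ^ p := by
  classical
  induction hn : s.card generalizing s with
  | zero => simp [Finset.card_eq_zero.1 hn]
  | succ n ih =>
    have hne : s.Nonempty := Finset.card_pos.1 (by omega)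
    -- Removing the vector with the smallest image avoids rearranging the sequence: all `n + 1`
    -- images are at least as long, so this one is dominated by the singular number of index `n`.
    obtain ⟨a, ha, hmin⟩ := s.exists_min_image (fun i => ‖T (v i)‖) hne
    rw [Finset.sum_range_succ, ← Finset.sum_erase_add _ _ ha]
    refine add_le_add (ih _ (by rw [Finset.card_erase_of_mem ha]; omega)) ?_
    have h1 := le_singularNumber T hv hT (s := s) (n := n) (by omega) (norm_nonneg _) hmin
    gcongr
    rw [← enorm_norm (T (v a))]
    exact Real.enorm_le_enorm_of_le (norm_nonneg _) h1

theorem tsum_enorm_rpow_le_schattenNorm {ι : Type*} (T : H →L[ℂ] H) {v : ι → H}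
    (hv : Orthonormal ℂ v) (hT : Pairwise fun i j => inner ℂ (T (v i)) (T (v j)) = 0)
    {p : ℝ≥0∞} (hp : p ≠ 0) (hpt : p ≠ ∞) :
    ∑' i, ‖T (v i)‖ₑ ^ p.toReal ≤ schattenNorm p T ^ p.toReal := by
  have hp' : 0 < p.toReal := ENNReal.toReal_pos hp hpt
  rw [schattenNorm, eLpNorm_eq_lintegral_rpow_enorm_toReal hp hpt, lintegral_count,
    ← ENNReal.rpow_mul, one_div_mul_cancel hp'.ne', ENNReal.rpow_one,
    ENNReal.tsum_eq_iSup_sum]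
  exact iSup_le fun s => (sum_le_sum_singularNumber T hv hT hp' s).trans (ENNReal.sum_le_tsum _)

/-! ### Greedy choice of orthonormal systems -/

theorem rank_starProjection_span_image_range_le (v : ℕ → H) (n : ℕ)
    [(Submodule.span ℂ (v '' Finset.range n)).HasOrthogonalProjection] :
    ((Submodule.span ℂ (v '' Finset.range n)).starProjection : H →ₗ[ℂ] H).rank ≤ n := by
  have h : ((Submodule.span ℂ (v '' Finset.range n)).starProjection : H →ₗ[ℂ] H).range ≤
      Submodule.span ℂ (v '' Finset.range n) := by
    rintro _ ⟨x, rfl⟩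
    exact Submodule.starProjection_apply_mem _ x
  refine (Submodule.rank_mono h).trans ((rank_span_le _).trans ?_)
  classical
  rw [← Finset.coe_image]
  refine (Cardinal.mk_coe_finset (s := (Finset.range n).image v)).trans_le ?_
  exact_mod_cast Finset.card_image_le.trans (Finset.card_range n).le

/-- A greedy choice that needs neither compactness nor a spectral theorem. After `n` vectors are
chosen on each side, compressing `T` to their orthogonal complements changes it by an operator of
rank at most `2n`, so the compression still has norm at least `singularNumber T (2 * n)`; a vector
nearly attaining half of it gives the next pair. This is the source of the index `2 * i` and the
factor `2`. -/
theorem exists_orthonormal_singularNumber (T : H →L[ℂ] H) (n : ℕ)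
    (hpos : ∀ i < n, 0 < singularNumber T (2 * i)) :
    ∃ u v : ℕ → H, (∀ i < n, ∀ j < n, inner ℂ (u i) (u j) = if i = j then (1 : ℂ) else 0) ∧
      (∀ i < n, ∀ j < n, inner ℂ (v i) (v j) = if i = j then (1 : ℂ) else 0) ∧
      ∀ i < n, singularNumber T (2 * i) ≤ 2 * ‖inner ℂ (u i) (T (v i))‖ := by
  induction n with
  | zero => exact ⟨0, 0, by simp, by simp, by simp⟩
  | succ n ih =>
    obtain ⟨u, v, hu, hv, huv⟩ := ih fun i hi => hpos i (by omega)
    set U := Submodule.span ℂ (u '' Finset.range n) with hU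
    set V := Submodule.span ℂ (v '' Finset.range n) with hV
    have : FiniteDimensional ℂ U :=
      FiniteDimensional.span_of_finite ℂ ((Finset.range n).finite_toSet.image u)
    have : FiniteDimensional ℂ V :=
      FiniteDimensional.span_of_finite ℂ ((Finset.range n).finite_toSet.image v)
    set PU := U.starProjection
    set PV := V.starProjection
    -- Chosen so that `T - F = (1 - PU) T (1 - PV)`.
    set F : H →L[ℂ] H := PU ∘L T ∘L (1 - PV) + T ∘L PV with hF
    have hrank : (F : H →ₗ[ℂ] H).rank ≤ (2 * n : ℕ) := by
      have h1 : ((PU ∘L T ∘L (1 - PV) : H →L[ℂ] H) : H →ₗ[ℂ] H).rank ≤ n :=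
        (LinearMap.rank_comp_le_left (T ∘L (1 - PV) : H →L[ℂ] H).toLinearMap
          (PU : H →ₗ[ℂ] H)).trans (rank_starProjection_span_image_range_le u n)
      have h2 : ((T ∘L PV : H →L[ℂ] H) : H →ₗ[ℂ] H).rank ≤ n :=
        (LinearMap.rank_comp_le_right (PV : H →ₗ[ℂ] H) (T : H →ₗ[ℂ] H)).trans
          (rank_starProjection_span_image_range_le v n)
      refine (LinearMap.rank_add_le _ _).trans ((add_le_add h1 h2).trans ?_)
      rw [two_mul]
      push_cast
      exact le_rfl
    have hs := hpos n (by omega)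
    have hle := singularNumber_le T F (2 * n) hrank
    have hTF : ∀ x, (T - F) x = T (x - PV x) - PU (T (x - PV x)) := by
      intro x
      simp [hF]
      abel
    -- The operator norm need not be attained; strict positivity of the singular number leaves room
    -- to lose a factor two.
    obtain ⟨x, hx⟩ : ∃ x, singularNumber T (2 * n) / 2 * ‖x‖ < ‖(T - F) x‖ := by
      by_contra! hcon
      have := (T - F).opNorm_le_bound (by positivity) hcon
      linarith
    set y := x - PV x with hy
    set z := T y - PU (T y) with hz
    have hyx : ‖y‖ ≤ ‖x‖ := by
      have h1 : inner ℂ y (PV x) = 0 :=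
        V.starProjection_inner_eq_zero x _ (V.starProjection_apply_mem x)
      have h2 := norm_add_sq_eq_norm_sq_add_norm_sq_of_inner_eq_zero (𝕜 := ℂ) y (PV x) h1
      rw [show y + PV x = x by rw [hy]; abel] at h2
      nlinarith [norm_nonneg (PV x), norm_nonneg x, norm_nonneg y, mul_self_nonneg ‖PV x‖]
    rw [hTF x] at hx
    have hz0 : 0 < ‖z‖ := lt_of_le_of_lt (by positivity) hx
    have hy0 : 0 < ‖y‖ := by
      refine norm_pos_iff.2 fun h => ?_
      simp [hz, h] at hz0
    have hyv : ∀ i < n, inner ℂ y (v i) = 0 := fun i hi =>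
      V.starProjection_inner_eq_zero x _ (Submodule.subset_span ⟨i, by simpa using hi, rfl⟩)
    have hzu : ∀ i < n, inner ℂ z (u i) = 0 := fun i hi =>
      U.starProjection_inner_eq_zero (T y) _ (Submodule.subset_span ⟨i, by simpa using hi, rfl⟩)
    have hext : ∀ (w : ℕ → H) (a : H), 0 < ‖a‖ → (∀ i < n, inner ℂ a (w i) = 0) →
        (∀ i < n, ∀ j < n, inner ℂ (w i) (w j) = if i = j then (1 : ℂ) else 0) →
        ∀ i < n + 1, ∀ j < n + 1,
          inner ℂ (Function.update w n (((‖a‖⁻¹ : ℝ) : ℂ) • a) i)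
            (Function.update w n (((‖a‖⁻¹ : ℝ) : ℂ) • a) j) = if i = j then (1 : ℂ) else 0 := by
      intro w a ha haw hw i hi j hj
      rcases Nat.lt_succ_iff_lt_or_eq.1 hi with hi | rfl <;>
      rcases Nat.lt_succ_iff_lt_or_eq.1 hj with hj | rfl
      · rw [Function.update_of_ne hi.ne, Function.update_of_ne hj.ne, hw i hi j hj]
      · rw [Function.update_of_ne hi.ne, Function.update_self, inner_smul_right,
          inner_eq_zero_symm.1 (haw i hi), if_neg hi.ne, mul_zero]
      · rw [Function.update_of_ne hj.ne, Function.update_self, inner_smul_left, haw j hj,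
          if_neg hj.ne', mul_zero]
      · rw [Function.update_self, inner_smul_left, inner_smul_right, if_pos rfl,
          inner_self_eq_norm_sq_to_K, Complex.conj_ofReal]
        have : (‖a‖ : ℂ) ≠ 0 := by exact_mod_cast ha.ne'
        push_cast
        field_simp
        simp
    refine ⟨Function.update u n (((‖z‖⁻¹ : ℝ) : ℂ) • z), Function.update v n (((‖y‖⁻¹ : ℝ) : ℂ) • y),
      hext u z hz0 hzu hu, hext v y hy0 hyv hv, fun i hi => ?_⟩
    rcases Nat.lt_succ_iff_lt_or_eq.1 hi with hi | rfl
    · rw [Function.update_of_ne hi.ne, Function.update_of_ne hi.ne]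
      exact huv i hi
    · rw [Function.update_self, Function.update_self, map_smul, inner_smul_left, inner_smul_right]
      -- The part of `T y` inside `U` is orthogonal to `z`, so after normalization the matrix entry
      -- is `‖z‖ / ‖y‖`, with `‖y‖ ≤ ‖x‖`.
      have h1 : inner ℂ z (T y) = ((‖z‖ ^ 2 : ℝ) : ℂ) := by
        have h2 : inner ℂ z (PU (T y)) = 0 :=
          U.starProjection_inner_eq_zero (T y) _ (U.starProjection_apply_mem _)
        have h3 : T y = z + PU (T y) := by rw [hz]; abel
        rw [h3, inner_add_right, h2, add_zero, inner_self_eq_norm_sq_to_K]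
        push_cast
        rfl
      have h4 : ‖(starRingEnd ℂ) ((‖z‖⁻¹ : ℝ) : ℂ) * (((‖y‖⁻¹ : ℝ) : ℂ) * inner ℂ z (T y))‖ =
          ‖z‖ / ‖y‖ := by
        rw [h1, Complex.conj_ofReal, ← Complex.ofReal_mul, ← Complex.ofReal_mul, Complex.norm_real,
          Real.norm_of_nonneg (by positivity)]
        field_simp
      rw [h4, mul_div_assoc', le_div_iff₀ hy0]
      nlinarith
 
/-- Bounds a Schatten norm from matrix entries between arbitrary finite orthonormal systems, without
prior knowledge that `T` is compact. One factor two of the constant comes from the greedy choice,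
the other from passing from even indices to all indices. -/
theorem schattenNorm_le_of_orthonormal {p : ℝ≥0∞} (hp : 1 ≤ p) (hpt : p ≠ ∞) (T : H →L[ℂ] H)
    (K : ℝ≥0∞)
    (h : ∀ (n : ℕ) (u v : Fin n → H), Orthonormal ℂ u → Orthonormal ℂ v →
      ∑ i, ‖inner ℂ (u i) (T (v i))‖ₑ ^ p.toReal ≤ K ^ p.toReal) :
    schattenNorm p T ≤ 4 * K := by
  have hp1 : 1 ≤ p.toReal := by
    simpa using ENNReal.toReal_mono hpt hp
  have hp' : 0 < p.toReal := one_pos.trans_le hp1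
  have key : ∀ n, ∑ i ∈ Finset.range n, ‖singularNumber T (2 * i)‖ₑ ^ p.toReal ≤
      (2 * K) ^ p.toReal := by
    intro n
    induction n with
    | zero => simp
    | succ n ih =>
      -- The greedy choice requires nonzero singular numbers; a vanishing one adds nothing to the
      -- sum.
      by_cases h0 : singularNumber T (2 * n) = 0
      · rw [Finset.sum_range_succ, h0]
        simpa [hp'] using ih
      have hpos : ∀ i < n + 1, 0 < singularNumber T (2 * i) := fun i hi =>
        ((singularNumber_nonneg T _).lt_of_ne (Ne.symm h0)).trans_le
          (singularNumber_antitone T (by omega))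
      obtain ⟨u, v, hu, hv, huv⟩ := exists_orthonormal_singularNumber T (n + 1) hpos
      have hu' : Orthonormal ℂ fun i : Fin (n + 1) => u i := orthonormal_iff_ite.2 fun i j => by
        rw [hu i i.2 j j.2]
        simp [Fin.ext_iff]
      have hv' : Orthonormal ℂ fun i : Fin (n + 1) => v i := orthonormal_iff_ite.2 fun i j => by
        rw [hv i i.2 j j.2]
        simp [Fin.ext_iff]
      have h1 := h (n + 1) _ _ hu' hv'
      rw [Finset.sum_range (fun i => ‖singularNumber T (2 * i)‖ₑ ^ p.toReal),
        ENNReal.mul_rpow_of_nonneg _ _ hp'.le]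
      refine le_trans ?_ (mul_le_mul_right h1 _)
      rw [Finset.mul_sum]
      refine Finset.sum_le_sum fun i _ => ?_
      rw [← ENNReal.mul_rpow_of_nonneg _ _ hp'.le]
      gcongr
      have h2 := huv i i.2
      have h3 : (2 : ℝ≥0∞) * ‖inner ℂ (u i) (T (v i))‖ₑ =
          ‖2 * ‖inner ℂ (u i) (T (v i))‖‖ₑ := by
        rw [enorm_mul, enorm_norm]
        congr 1
        simp [enorm_eq_nnnorm]
      rw [h3]
      exact Real.enorm_le_enorm_of_le (singularNumber_nonneg _ _) h2
  have heven : ∑' i, ‖singularNumber T (2 * i)‖ₑ ^ p.toReal ≤ (2 * K) ^ p.toReal := by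
    rw [ENNReal.tsum_eq_iSup_nat]
    exact iSup_le key
  have hodd : ∑' i, ‖singularNumber T (2 * i + 1)‖ₑ ^ p.toReal ≤ (2 * K) ^ p.toReal := by
    refine le_trans (ENNReal.tsum_le_tsum fun i => ?_) heven
    gcongr
    exact Real.enorm_le_enorm_of_le (singularNumber_nonneg _ _)
      (singularNumber_antitone T (by omega))
  rw [schattenNorm, eLpNorm_eq_lintegral_rpow_enorm_toReal (by positivity) hpt, lintegral_count,
    one_div, ENNReal.rpow_inv_le_iff hp',
    ← tsum_even_add_odd ENNReal.summable ENNReal.summable]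
  -- Even and odd indices contribute equally, and `2 ≤ 2 ^ p` since `p ≥ 1`.
  calc _ ≤ (2 * K) ^ p.toReal + (2 * K) ^ p.toReal := add_le_add heven hodd
    _ = 2 * (2 * K) ^ p.toReal := (two_mul _).symm
    _ ≤ 2 ^ p.toReal * (2 * K) ^ p.toReal := by
        gcongr
        exact ENNReal.le_rpow_self_of_one_le (by norm_num) hp1
    _ = (4 * K) ^ p.toReal := by
        rw [← ENNReal.mul_rpow_of_nonneg _ _ hp'.le, ← mul_assoc]
        norm_num

end Singular

/-! ### Schmidt decomposition -/

section Schmidt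

variable {H : Type*} [NormedAddCommGroup H] [InnerProductSpace ℂ H]

theorem isCompactOperator_of_rank_le (F : H →L[ℂ] H) {n : ℕ} (h : (F : H →ₗ[ℂ] H).rank ≤ n) :
    IsCompactOperator F := by
  have : FiniteDimensional ℂ (F : H →ₗ[ℂ] H).range :=
    Module.rank_lt_aleph0_iff.1 (lt_of_le_of_lt h Cardinal.natCast_lt_aleph0)
  let G : H →L[ℂ] (F : H →ₗ[ℂ] H).range := F.codRestrict _ fun x => ⟨x, rfl⟩
  have : ProperSpace (F : H →ₗ[ℂ] H).range := FiniteDimensional.proper ℂ _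
  exact (isCompactOperator_of_locallyCompactSpace_rng
    ((F : H →ₗ[ℂ] H).range.subtypeL)).comp_clm G

theorem tendsto_singularNumber_zero {p : ℝ≥0∞} (hp : p ≠ 0) (hpt : p ≠ ∞) {T : H →L[ℂ] H}
    (hT : schattenNorm p T < ∞) : Filter.Tendsto (singularNumber T) Filter.atTop (nhds 0) := by
  have hp' : 0 < p.toReal := ENNReal.toReal_pos hp hpt
  rw [schattenNorm, eLpNorm_lt_top_iff_lintegral_rpow_enorm_lt_top hp hpt, lintegral_count] at hT
  have h1 := (ENNReal.tendsto_atTop_zero_of_tsum_ne_top hT.ne).ennrpow_const (1 / p.toReal)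
  simp only [← ENNReal.rpow_mul, mul_one_div_cancel hp'.ne', ENNReal.rpow_one] at h1
  rw [ENNReal.zero_rpow_of_pos (by positivity)] at h1
  exact tendsto_zero_iff_enorm_tendsto_zero.2 h1

/-- Summability forces the singular numbers to zero, so `T` is a norm limit of finite rank
operators. -/
theorem isCompactOperator_of_schattenNorm_lt_top [CompleteSpace H] {p : ℝ≥0∞} (hp : p ≠ 0)
    (hpt : p ≠ ∞) {T : H →L[ℂ] H} (hT : schattenNorm p T < ∞) : IsCompactOperator T := by
  have h := tendsto_singularNumber_zero hp hpt hT
  choose F hF hTF using fun n : ℕ =>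
    exists_singularNumber_lt T n (Nat.one_div_pos_of_nat (α := ℝ) (n := n))
  refine isCompactOperator_of_tendsto (F := F) (l := Filter.atTop) ?_
    (Filter.Eventually.of_forall fun n => isCompactOperator_of_rank_le (F n) (hF n))
  rw [tendsto_iff_norm_sub_tendsto_zero]
  refine squeeze_zero (fun n => norm_nonneg _) (fun n => ?_)
    (by simpa using h.add (tendsto_one_div_add_atTop_nhds_zero_nat (𝕜 := ℝ)))
  rw [norm_sub_rev, ← one_div]
  exact (hTF n).le

/-- The union of Hilbert bases of the orthogonal subspaces is complete because anything orthogonal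
to it is orthogonal to every `V k`. It is used with the eigenspaces of a compact self-adjoint
operator, indexed by `ℂ`. -/
theorem exists_hilbertBasis_subordinate.{u} {H : Type u} [NormedAddCommGroup H]
    [InnerProductSpace ℂ H] [CompleteSpace H] {κ : Type} (V : κ → Submodule ℂ H)
    [∀ k, CompleteSpace (V k)] (hV : OrthogonalFamily ℂ (fun k => V k) fun k => (V k).subtypeₗᵢ)
    (h : (⨆ k, V k)ᗮ = ⊥) :
    ∃ (ι : Type u) (v : HilbertBasis ι ℂ H), ∀ i, ∃ k, v i ∈ V k := by
  choose w b _ using fun k => exists_hilbertBasis ℂ (V k)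
  have hon := hV.orthonormal_sigma_orthonormal (v_family := fun k => b k)
    fun k => (b k).orthonormal
  have hbot : (Submodule.span ℂ (Set.range fun a : Σ k, w k =>
      (V a.1).subtypeₗᵢ (b a.1 a.2)))ᗮ = ⊥ := by
    rw [eq_bot_iff, ← h]
    intro x hx
    rw [Submodule.mem_orthogonal'] at hx ⊢
    suffices h : (⨆ k, V k) ≤ (ℂ ∙ x)ᗮ by
      intro u hu
      exact Submodule.mem_orthogonal_singleton_iff_inner_right.1 (h hu)
    refine iSup_le fun k y hy => ?_
    rw [Submodule.mem_orthogonal_singleton_iff_inner_right]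
    have h1 := ((b k).hasSum_repr ⟨y, hy⟩).mapL ((innerSL ℂ x) ∘L (V k).subtypeL)
    have h2 : ∀ i, inner ℂ x ((b k i : V k) : H) = 0 :=
      fun i => hx _ (Submodule.subset_span ⟨⟨k, i⟩, rfl⟩)
    simp only [map_smul, ContinuousLinearMap.comp_apply, Submodule.subtypeL_apply,
      innerSL_apply_apply, h2, smul_zero] at h1
    exact h1.unique hasSum_zero
  refine ⟨_, HilbertBasis.mkOfOrthogonalEqBot hon hbot, fun i => ⟨i.1, ?_⟩⟩
  rw [HilbertBasis.coe_mkOfOrthogonalEqBot]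
  exact (b i.1 i.2).2

theorem exists_hilbertBasis_eigenvectors.{u} {H : Type u} [NormedAddCommGroup H]
    [InnerProductSpace ℂ H] [CompleteSpace H] {S : H →L[ℂ] H} (hS : IsCompactOperator S)
    (hS' : (S : H →ₗ[ℂ] H).IsSymmetric) :
    ∃ (ι : Type u) (v : HilbertBasis ι ℂ H), ∀ i, ∃ μ : ℂ, S (v i) = μ • v i := by
  have hcl : ∀ μ : ℂ, IsClosed (Module.End.eigenspace (S : H →ₗ[ℂ] H) μ : Set H) := fun μ => by
    have : (Module.End.eigenspace (S : H →ₗ[ℂ] H) μ : Set H) = {x | S x = μ • x} := by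
      ext x
      simp
    rw [this]
    exact isClosed_eq S.continuous (continuous_const_smul μ)
  have hcomp : ∀ μ : ℂ, CompleteSpace (Module.End.eigenspace (S : H →ₗ[ℂ] H) μ) := fun μ =>
    (hcl μ).completeSpace_coe
  obtain ⟨ι, v, hv⟩ := exists_hilbertBasis_subordinate _ hS'.orthogonalFamily_eigenspaces
    (ContinuousLinearMap.orthogonalComplement_iSup_eigenspaces_eq_bot hS hS')
  refine ⟨ι, v, fun i => ?_⟩
  obtain ⟨μ, hμ⟩ := hv i
  exact ⟨μ, Module.End.mem_eigenspace_iff.1 hμ⟩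

/-- In an eigenbasis of `T* T` one has `⟨T v_i, T v_j⟩ = ⟨v_i, T* T v_j⟩ = μ_j ⟨v_i, v_j⟩`. -/
theorem exists_hilbertBasis_pairwise_inner_map_eq_zero.{u} {H : Type u} [NormedAddCommGroup H]
    [InnerProductSpace ℂ H] [CompleteSpace H] {T : H →L[ℂ] H} (hT : IsCompactOperator T) :
    ∃ (ι : Type u) (v : HilbertBasis ι ℂ H),
      Pairwise fun i j => inner ℂ (T (v i)) (T (v j)) = 0 := by
  set S : H →L[ℂ] H := ContinuousLinearMap.adjoint T ∘L T with hS
  have hSc : IsCompactOperator S := hT.clm_comp (ContinuousLinearMap.adjoint T)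
  have hSin : ∀ x y, inner ℂ x (S y) = inner ℂ (T x) (T y) := fun x y => by
    simp [hS, ContinuousLinearMap.adjoint_inner_right]
  have hSs : (S : H →ₗ[ℂ] H).IsSymmetric := fun x y => by
    simp [hS, ContinuousLinearMap.adjoint_inner_right, ContinuousLinearMap.adjoint_inner_left]
  obtain ⟨ι, v, hv⟩ := exists_hilbertBasis_eigenvectors hSc hSs
  refine ⟨ι, v, fun i j hij => ?_⟩
  obtain ⟨μ, hμ⟩ := hv j
  rw [← hSin, hμ, inner_smul_right, v.orthonormal.2 hij, mul_zero]

/-- Schmidt decomposition `T = ∑ t_j ⟨v_j, ·⟩ u_j` of an operator in a Schatten class. -/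
theorem exists_schmidt_decomposition.{u} {H : Type u} [NormedAddCommGroup H]
    [InnerProductSpace ℂ H] [CompleteSpace H] {p : ℝ≥0∞} (hp : p ≠ 0) (hpt : p ≠ ∞)
    {T : H →L[ℂ] H} (hT : schattenNorm p T < ∞) :
    ∃ (J : Type u) (_ : Countable J) (t : J → ℝ) (u v : J → H), Orthonormal ℂ u ∧
      Orthonormal ℂ v ∧ (∀ j, 0 ≤ t j) ∧
      (∀ x, HasSum (fun j => ((t j : ℂ) * inner ℂ (v j) x) • u j) (T x)) ∧
      ∑' j, ‖t j‖ₑ ^ p.toReal ≤ schattenNorm p T ^ p.toReal := by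
  have hp' : 0 < p.toReal := ENNReal.toReal_pos hp hpt
  obtain ⟨ι, b, hb⟩ := exists_hilbertBasis_pairwise_inner_map_eq_zero
    (isCompactOperator_of_schattenNorm_lt_top hp hpt hT)
  have hsum := tsum_enorm_rpow_le_schattenNorm T b.orthonormal hb hp hpt
  have hfin : ∑' i, ‖T (b i)‖ₑ ^ p.toReal ≠ ∞ :=
    (hsum.trans_lt (ENNReal.rpow_lt_top_of_nonneg hp'.le hT.ne)).ne
  -- `H` need not be separable, but only countably many terms of a convergent sum are nonzero.
  -- Restricting to them also makes the normalization of `T (b j)` legitimate.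
  have hcount : {i | T (b i) ≠ 0}.Countable := by
    refine (Summable.countable_support_ennreal hfin).mono fun i hi => ?_
    simpa [hp'] using hi
  refine ⟨{i | T (b i) ≠ 0}, hcount.to_subtype, fun j => ‖T (b j)‖,
    fun j => ((‖T (b j)‖⁻¹ : ℝ) : ℂ) • T (b j), fun j => b j, ?_,
    b.orthonormal.comp _ Subtype.val_injective, fun j => norm_nonneg _, fun x => ?_, ?_⟩
  · refine ⟨fun j => ?_, fun i j hij => ?_⟩
    · have : ‖T (b j)‖ ≠ 0 := norm_ne_zero_iff.2 j.2
      rw [norm_smul, Complex.norm_real, norm_inv, norm_norm, inv_mul_cancel₀ this]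
    · simp only [inner_smul_left, inner_smul_right]
      rw [hb fun h => hij (Subtype.ext h)]
      simp
  · have h1 := (b.hasSum_repr x).mapL T
    rw [← hasSum_subtype_iff_of_support_subset (s := {i | T (b i) ≠ 0})] at h1
    · convert h1 using 2 with j
      have : (‖T (b j)‖ : ℂ) ≠ 0 := by exact_mod_cast norm_ne_zero_iff.2 j.2
      simp only [Function.comp_apply, map_smul, HilbertBasis.repr_apply_apply, smul_smul]
      congr 1
      push_cast
      field_simp
    · intro i hi h0
      simp [h0] at hi
  · refine le_trans ?_ hsum
    simp only [enorm_norm]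
    exact ENNReal.tsum_comp_le_tsum_of_injective Subtype.val_injective
      (fun i => ‖T (b i)‖ₑ ^ p.toReal)

end Schmidt

/-! ### Coherent families, lower symbols and localization operators -/

section Coherent

/-- A weight bounded by `W` both pointwise and in `L^1` has norm at most `W` in every dual space
`L^{q'}`. This makes the localization form bounded for all `q` at once. -/
theorem lintegral_enorm_mul_le_eLpNorm_mul {α E : Type*} [MeasurableSpace α] {μ : Measure α}
    [NormedAddCommGroup E] {q : ℝ≥0∞} (hq : 1 ≤ q) {F : α → E} (hF : AEStronglyMeasurable F μ)
    {w : α → ℝ≥0∞} (hw : AEMeasurable w μ) {W : ℝ≥0∞} (hW : W ≠ ∞) (h1 : ∫⁻ a, w a ∂μ ≤ W)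
    (h2 : ∀ a, w a ≤ W) : ∫⁻ a, ‖F a‖ₑ * w a ∂μ ≤ eLpNorm F q μ * W := by
  by_cases hqt : q = ∞
  · subst hqt
    calc ∫⁻ a, ‖F a‖ₑ * w a ∂μ ≤ ∫⁻ a, eLpNorm F ∞ μ * w a ∂μ := by
          refine lintegral_mono_ae ?_
          filter_upwards [ae_le_eLpNormEssSup (f := F) (μ := μ)] with a ha
          rw [eLpNorm_exponent_top]
          gcongr
      _ = eLpNorm F ∞ μ * ∫⁻ a, w a ∂μ := lintegral_const_mul'' _ hw
      _ ≤ _ := by gcongr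
  rcases eq_or_ne W 0 with rfl | hW0
  · have : ∀ a, w a = 0 := fun a => le_antisymm (h2 a) bot_le
    simp [this]
  have hq1 : 1 ≤ q.toReal := by simpa using ENNReal.toReal_mono hqt hq
  have hq' : 0 < q.toReal := one_pos.trans_le hq1
  have h3 := lintegral_mul_rpow_le hq1 hF.enorm (w := fun a => w a / W) (hw.div_const W) (by
    simp only [div_eq_mul_inv]
    rw [lintegral_mul_const'' _ hw]
    exact (ENNReal.div_le_iff hW0 hW).2 (by simpa using h1))
  have h4 : ∫⁻ a, ‖F a‖ₑ * (w a / W) ∂μ ≤ eLpNorm F q μ := by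
    rw [eLpNorm_eq_lintegral_rpow_enorm_toReal (by positivity) hqt, one_div,
      ENNReal.le_rpow_inv_iff hq']
    refine h3.trans (lintegral_mono fun a => ?_)
    calc ‖F a‖ₑ ^ q.toReal * (w a / W) ≤ ‖F a‖ₑ ^ q.toReal * 1 := by
          gcongr
          exact (ENNReal.div_le_iff hW0 hW).2 (by simpa using h2 a)
      _ = _ := mul_one _
  have h5 : ∀ a, ‖F a‖ₑ * w a = ‖F a‖ₑ * (w a / W) * W := fun a => by
    rw [mul_assoc, ENNReal.div_mul_cancel hW0 hW]
  simp only [h5]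
  rw [lintegral_mul_const' _ _ hW]
  gcongr

theorem tsum_inner_sq_le {ι H : Type*} [NormedAddCommGroup H] [InnerProductSpace ℂ H] {v : ι → H}
    (hv : Orthonormal ℂ v) (x : H) : ∑' i, ‖inner ℂ (v i) x‖ₑ ^ 2 ≤ ‖x‖ₑ ^ 2 := by
  rw [ENNReal.tsum_eq_iSup_sum]
  refine iSup_le fun s => ?_
  have h := hv.sum_inner_products_le x (s := s)
  have h2 : ∑ i ∈ s, ‖inner ℂ (v i) x‖ₑ ^ 2 =
      ENNReal.ofReal (∑ i ∈ s, ‖inner ℂ (v i) x‖ ^ 2) := by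
    rw [ENNReal.ofReal_sum_of_nonneg fun i _ => by positivity]
    simp [ENNReal.ofReal_pow, ofReal_norm]
  rw [h2, ← ofReal_norm, ← ENNReal.ofReal_pow (norm_nonneg _)]
  exact ENNReal.ofReal_le_ofReal h

theorem enorm_inner_le {H : Type*} [NormedAddCommGroup H] [InnerProductSpace ℂ H] (x y : H) :
    ‖inner ℂ x y‖ₑ ≤ ‖x‖ₑ * ‖y‖ₑ := by
  simp only [← ofReal_norm]
  rw [← ENNReal.ofReal_mul (norm_nonneg _)]
  exact ENNReal.ofReal_le_ofReal (norm_inner_le_norm x y)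

theorem lintegral_mul_le_of_sq_le {α : Type*} [MeasurableSpace α] {μ : Measure α}
    {f g : α → ℝ≥0∞} (hf : AEMeasurable f μ) (hg : AEMeasurable g μ) {a b : ℝ≥0∞}
    (ha : ∫⁻ x, f x ^ 2 ∂μ ≤ a ^ 2) (hb : ∫⁻ x, g x ^ 2 ∂μ ≤ b ^ 2) :
    ∫⁻ x, f x * g x ∂μ ≤ a * b := by
  have h := ENNReal.lintegral_mul_le_Lp_mul_Lq μ Real.HolderConjugate.two_two hf hg
  simp only [ENNReal.rpow_ofNat, Pi.mul_apply] at h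
  refine h.trans (mul_le_mul' ?_ ?_)
  · rw [one_div, ENNReal.rpow_inv_le_iff (by norm_num)]
    exact_mod_cast ha
  · rw [one_div, ENNReal.rpow_inv_le_iff (by norm_num)]
    exact_mod_cast hb

theorem tsum_inner_mul_inner_le {ι H : Type*} [NormedAddCommGroup H] [InnerProductSpace ℂ H]
    {u v : ι → H} (hu : Orthonormal ℂ u) (hv : Orthonormal ℂ v) (x y : H) :
    ∑' i, ‖inner ℂ (u i) x‖ₑ * ‖inner ℂ (v i) y‖ₑ ≤ ‖x‖ₑ * ‖y‖ₑ := by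
  let _ : MeasurableSpace ι := ⊤
  rw [← lintegral_count]
  refine lintegral_mul_le_of_sq_le measurable_from_top.aemeasurable
    measurable_from_top.aemeasurable ?_ ?_
  · rw [lintegral_count]; exact tsum_inner_sq_le hu x
  · rw [lintegral_count]; exact tsum_inner_sq_le hv y

variable {Z : Type*} [MeasurableSpace Z] {H : Type*} [NormedAddCommGroup H]
  [InnerProductSpace ℂ H]

/-- A measurable family of vectors of norm at most one which satisfies Bessel's inequality
`∫ |⟨φ_z, f⟩|² dμ(z) ≤ ‖f‖²`. -/
structure IsCoherentFamily (μ : Measure Z) (φ : Z → H) : Prop where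
  stronglyMeasurable : StronglyMeasurable φ
  norm_le_one : ∀ z, ‖φ z‖ ≤ 1
  lintegral_le : ∀ f : H, ∫⁻ z, ‖inner ℂ (φ z) f‖ₑ ^ 2 ∂μ ≤ ‖f‖ₑ ^ 2

/-- The lower symbol `z ↦ ⟨φ_z, T φ_z⟩` of an operator. -/
noncomputable def lowerSymbol (φ : Z → H) (T : H →L[ℂ] H) (z : Z) : ℂ := inner ℂ (φ z) (T (φ z))

namespace IsCoherentFamily

variable {μ : Measure Z} {φ : Z → H}

theorem measurable_inner_left (hφ : IsCoherentFamily μ φ) (f : H) :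
    StronglyMeasurable fun z => inner ℂ (φ z) f :=
  hφ.stronglyMeasurable.inner stronglyMeasurable_const

theorem measurable_inner_right (hφ : IsCoherentFamily μ φ) (f : H) :
    StronglyMeasurable fun z => inner ℂ f (φ z) :=
  stronglyMeasurable_const.inner hφ.stronglyMeasurable

theorem enorm_le_one (hφ : IsCoherentFamily μ φ) (z : Z) : ‖φ z‖ₑ ≤ 1 := by
  rw [← ofReal_norm, ← ENNReal.ofReal_one]
  exact ENNReal.ofReal_le_ofReal (hφ.norm_le_one z)

theorem lintegral_inner_mul_inner_le (hφ : IsCoherentFamily μ φ) (g f : H) :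
    ∫⁻ z, ‖inner ℂ g (φ z)‖ₑ * ‖inner ℂ (φ z) f‖ₑ ∂μ ≤ ‖g‖ₑ * ‖f‖ₑ := by
  refine lintegral_mul_le_of_sq_le (hφ.measurable_inner_right g).enorm.aemeasurable
    (hφ.measurable_inner_left f).enorm.aemeasurable ?_ (hφ.lintegral_le f)
  refine le_trans (le_of_eq ?_) (hφ.lintegral_le g)
  congr 1 with z
  rw [← ofReal_norm, ← ofReal_norm, norm_inner_symm]

theorem enorm_inner_mul_inner_le (hφ : IsCoherentFamily μ φ) (g f : H) (z : Z) :
    ‖inner ℂ g (φ z)‖ₑ * ‖inner ℂ (φ z) f‖ₑ ≤ ‖g‖ₑ * ‖f‖ₑ := by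
  have h := hφ.enorm_le_one z
  calc ‖inner ℂ g (φ z)‖ₑ * ‖inner ℂ (φ z) f‖ₑ
      ≤ (‖g‖ₑ * ‖φ z‖ₑ) * (‖φ z‖ₑ * ‖f‖ₑ) := by
        gcongr <;> exact enorm_inner_le _ _
    _ ≤ (‖g‖ₑ * 1) * (1 * ‖f‖ₑ) := by gcongr
    _ = _ := by simp

theorem stronglyMeasurable_lowerSymbol (hφ : IsCoherentFamily μ φ) (T : H →L[ℂ] H) :
    StronglyMeasurable (lowerSymbol φ T) :=
  hφ.stronglyMeasurable.inner (T.continuous.comp_stronglyMeasurable hφ.stronglyMeasurable)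

theorem norm_lowerSymbol_le (hφ : IsCoherentFamily μ φ) (T : H →L[ℂ] H) (z : Z) :
    ‖lowerSymbol φ T z‖ ≤ ‖T‖ := by
  have h := hφ.norm_le_one z
  calc ‖lowerSymbol φ T z‖ ≤ ‖φ z‖ * ‖T (φ z)‖ := norm_inner_le_norm _ _
    _ ≤ 1 * (‖T‖ * 1) := by
        gcongr
        exact (T.le_opNorm _).trans (by gcongr)
    _ = ‖T‖ := by ring

/-- By the Schmidt decomposition the symbol is at most `∑ t_j w_j(z)` with `w_j(z) = |⟨u_j,
φ_z⟩⟨v_j, φ_z⟩|`. Bessel for the orthonormal systems gives `∑_j w_j(z) ≤ 1`, and Bessel for the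
coherent family gives `∫ w_j ≤ 1`. Jensen in `j` and integration in `z` then give constant one. -/
theorem eLpNorm_lowerSymbol_le [CompleteSpace H] (hφ : IsCoherentFamily μ φ) {p : ℝ≥0∞}
    (hp : 1 ≤ p) (T : H →L[ℂ] H) : eLpNorm (lowerSymbol φ T) p μ ≤ schattenNorm p T := by
  have hp0 : p ≠ 0 := by positivity
  by_cases hpt : p = ∞
  · subst hpt
    refine le_trans ?_ (enorm_le_schattenNorm hp0 T)
    rw [eLpNorm_exponent_top, ← ofReal_norm]
    exact eLpNormEssSup_le_of_ae_bound (Filter.Eventually.of_forall (hφ.norm_lowerSymbol_le T))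
  by_cases hT : schattenNorm p T = ∞
  · simp [hT]
  have hp1 : 1 ≤ p.toReal := by simpa using ENNReal.toReal_mono hpt hp
  have hp' : 0 < p.toReal := one_pos.trans_le hp1
  obtain ⟨J, _, t, u, v, hu, hv, -, hsum, htp⟩ :=
    exists_schmidt_decomposition hp0 hpt (lt_top_iff_ne_top.2 hT)
  rw [eLpNorm_eq_lintegral_rpow_enorm_toReal hp0 hpt, one_div, ENNReal.rpow_inv_le_iff hp']
  refine le_trans ?_ htp
  set w : J → Z → ℝ≥0∞ := fun j z => ‖inner ℂ (u j) (φ z)‖ₑ * ‖inner ℂ (v j) (φ z)‖ₑ with hw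
  have hwm : ∀ j, Measurable (w j) := fun j =>
    (hφ.measurable_inner_right _).enorm.mul (hφ.measurable_inner_right _).enorm
  have hw1 : ∀ z, ∑' j, w j z ≤ 1 := fun z =>
    (tsum_inner_mul_inner_le hu hv (φ z) (φ z)).trans
      (mul_le_one' (hφ.enorm_le_one z) (hφ.enorm_le_one z))
  have hw2 : ∀ j, ∫⁻ z, w j z ∂μ ≤ 1 := fun j => by
    refine le_trans (le_of_eq ?_) ((hφ.lintegral_inner_mul_inner_le (u j) (v j)).trans ?_)
    · congr 1 with z
      simp only [hw]
      congr 1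
      rw [← ofReal_norm, ← ofReal_norm, norm_inner_symm]
    · rw [← ofReal_norm, ← ofReal_norm, hu.1, hv.1]
      simp
  have hB : ∀ z, ‖lowerSymbol φ T z‖ₑ ≤ ∑' j, ‖t j‖ₑ * w j z := by
    intro z
    have h1 := (hsum (φ z)).mapL (innerSL ℂ (φ z))
    simp only [innerSL_apply_apply] at h1
    rw [lowerSymbol, ← h1.tsum_eq]
    refine (enorm_tsum_le_tsum_enorm).trans (ENNReal.tsum_le_tsum fun j => le_of_eq ?_)
    rw [inner_smul_right, enorm_mul, enorm_mul, hw, ← inner_conj_symm (φ z) (u j)]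
    simp only [← ofReal_norm, RCLike.norm_conj, Complex.norm_real]
    ring
  calc ∫⁻ z, ‖lowerSymbol φ T z‖ₑ ^ p.toReal ∂μ
      ≤ ∫⁻ z, ∑' j, ‖t j‖ₑ ^ p.toReal * w j z ∂μ := by
        refine lintegral_mono fun z => ?_
        exact (ENNReal.rpow_le_rpow (hB z) hp'.le).trans (tsum_mul_rpow_le hp1 _ _ (hw1 z))
    _ = ∑' j, ‖t j‖ₑ ^ p.toReal * ∫⁻ z, w j z ∂μ := by
        rw [lintegral_tsum fun j => ((hwm j).const_mul _).aemeasurable]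
        congr 1 with j
        rw [lintegral_const_mul _ (hwm j)]
    _ ≤ ∑' j, ‖t j‖ₑ ^ p.toReal := by
        refine ENNReal.tsum_le_tsum fun j => ?_
        calc _ ≤ ‖t j‖ₑ ^ p.toReal * 1 := by gcongr; exact hw2 j
          _ = _ := mul_one _

/-! ### Localization operators with symbols in `L^q`. -/

section Localization

variable {q : ℝ≥0∞}

theorem lintegral_localization_le (hφ : IsCoherentFamily μ φ) (hq : 1 ≤ q) {F : Z → ℂ}
    (hF : AEStronglyMeasurable F μ) (g f : H) :
    ∫⁻ z, ‖F z * (inner ℂ g (φ z) * inner ℂ (φ z) f)‖ₑ ∂μ ≤ eLpNorm F q μ * (‖g‖ₑ * ‖f‖ₑ) := by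
  simp only [enorm_mul]
  exact lintegral_enorm_mul_le_eLpNorm_mul hq hF
    ((hφ.measurable_inner_right g).enorm.mul (hφ.measurable_inner_left f).enorm).aemeasurable
    (ENNReal.mul_ne_top enorm_ne_top enorm_ne_top)
    (hφ.lintegral_inner_mul_inner_le g f) (hφ.enorm_inner_mul_inner_le g f)

theorem integrable_localization (hφ : IsCoherentFamily μ φ) (hq : 1 ≤ q) {F : Z → ℂ}
    (hF : MemLp F q μ) (g f : H) :
    Integrable (fun z => F z * (inner ℂ g (φ z) * inner ℂ (φ z) f)) μ := by
  refine ⟨hF.1.mul ((hφ.measurable_inner_right g).mul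
    (hφ.measurable_inner_left f)).aestronglyMeasurable, ?_⟩
  exact (hφ.lintegral_localization_le hq hF.1 g f).trans_lt
    (ENNReal.mul_lt_top hF.2 (ENNReal.mul_lt_top enorm_lt_top enorm_lt_top))

variable [Fact (1 ≤ q)]

theorem norm_integral_localization_le (hφ : IsCoherentFamily μ φ) (F : Lp ℂ q μ) (g f : H) :
    ‖∫ z, F z * (inner ℂ g (φ z) * inner ℂ (φ z) f) ∂μ‖ ≤ ‖F‖ * ‖g‖ * ‖f‖ := by
  have h := (enorm_integral_le_lintegral_enorm _).trans
    (hφ.lintegral_localization_le (q := q) Fact.out (Lp.aestronglyMeasurable F) g f)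
  rw [← Lp.enorm_def, ← ofReal_norm, ← ofReal_norm, ← ofReal_norm, ← ofReal_norm,
    ← ENNReal.ofReal_mul (norm_nonneg _), ← ENNReal.ofReal_mul (norm_nonneg _),
    ENNReal.ofReal_le_ofReal_iff (by positivity)] at h
  linarith

/-- The sesquilinear form `(g, f) ↦ ∫ F(z) ⟨g, φ_z⟩ ⟨φ_z, f⟩ dμ(z)`. -/
noncomputable def localizationForm (hφ : IsCoherentFamily μ φ) (F : Lp ℂ q μ) :
    H →L⋆[ℂ] H →L[ℂ] ℂ :=
  LinearMap.mkContinuous₂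
    (LinearMap.mk₂'ₛₗ (starRingEnd ℂ) (RingHom.id ℂ)
      (fun g f => ∫ z, F z * (inner ℂ g (φ z) * inner ℂ (φ z) f) ∂μ)
      (fun g₁ g₂ f => by
        rw [← integral_add (hφ.integrable_localization Fact.out (Lp.memLp F) g₁ f)
          (hφ.integrable_localization Fact.out (Lp.memLp F) g₂ f)]
        congr 1 with z
        rw [inner_add_left]
        ring)
      (fun c g f => by
        rw [smul_eq_mul, ← integral_const_mul]
        congr 1 with z
        rw [inner_smul_left]
        ring)
      (fun g f₁ f₂ => by
        rw [← integral_add (hφ.integrable_localization Fact.out (Lp.memLp F) g f₁)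
          (hφ.integrable_localization Fact.out (Lp.memLp F) g f₂)]
        congr 1 with z
        rw [inner_add_right]
        ring)
      (fun c g f => by
        rw [RingHom.id_apply, smul_eq_mul, ← integral_const_mul]
        congr 1 with z
        rw [inner_smul_right]
        ring))
    ‖F‖ (fun g f => hφ.norm_integral_localization_le F g f)

theorem localizationForm_apply (hφ : IsCoherentFamily μ φ) (F : Lp ℂ q μ) (g f : H) :
    hφ.localizationForm F g f = ∫ z, F z * (inner ℂ g (φ z) * inner ℂ (φ z) f) ∂μ := rfl

variable [CompleteSpace H]

/-- The localization operator `∫ F(z) φ_z ⊗ φ_z dμ(z)`. -/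
noncomputable def localizationOp (hφ : IsCoherentFamily μ φ) (F : Lp ℂ q μ) : H →L[ℂ] H :=
  -- The operator representing the form acts on its first argument `g`; the adjoint moves it onto
  -- `f`.
  ContinuousLinearMap.adjoint
    (InnerProductSpace.continuousLinearMapOfBilin (hφ.localizationForm F))

theorem inner_localizationOp (hφ : IsCoherentFamily μ φ) (F : Lp ℂ q μ) (g f : H) :
    inner ℂ g (hφ.localizationOp F f) = ∫ z, F z * (inner ℂ g (φ z) * inner ℂ (φ z) f) ∂μ := by
  rw [localizationOp, ContinuousLinearMap.adjoint_inner_right,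
    InnerProductSpace.continuousLinearMapOfBilin_apply, localizationForm_apply]

theorem enorm_inner_localizationOp_le (hφ : IsCoherentFamily μ φ) (F : Lp ℂ q μ) (g f : H) :
    ‖inner ℂ g (hφ.localizationOp F f)‖ₑ ≤
      ∫⁻ z, ‖F z‖ₑ * (‖inner ℂ g (φ z)‖ₑ * ‖inner ℂ (φ z) f‖ₑ) ∂μ := by
  rw [inner_localizationOp]
  refine (enorm_integral_le_lintegral_enorm _).trans (le_of_eq ?_)
  simp only [enorm_mul]

theorem norm_localizationOp_le (hφ : IsCoherentFamily μ φ) (F : Lp ℂ q μ) :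
    ‖hφ.localizationOp F‖ ≤ ‖F‖ := by
  refine ContinuousLinearMap.opNorm_le_bound _ (norm_nonneg _) fun f => ?_
  -- Testing the form against the image of `f` itself produces `‖A f‖² ≤ ‖F‖ ‖A f‖ ‖f‖`.
  have h := hφ.norm_integral_localization_le F (hφ.localizationOp F f) f
  rw [← hφ.inner_localizationOp, inner_self_eq_norm_sq_to_K, norm_pow, RCLike.norm_ofReal,
    abs_norm] at h
  rcases (norm_nonneg (hφ.localizationOp F f)).eq_or_lt with h0 | h0
  · rw [← h0]; positivity
  · nlinarith

/-- Dual to the bound for lower symbols: the entries `⟨u_j, A v_j⟩` are averages of `F` with weights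
`w_j(z)` of the same kind, so Jensen is now applied in `z` and the sum is taken over `j`. The
constant `4` is that of `schattenNorm_le_of_orthonormal`. -/
theorem schattenNorm_localizationOp_le (hφ : IsCoherentFamily μ φ) (F : Lp ℂ q μ) :
    schattenNorm q (hφ.localizationOp F) ≤ 4 * ‖F‖ₑ := by
  have hq : 1 ≤ q := Fact.out
  by_cases hqt : q = ∞
  · subst hqt
    refine (schattenNorm_top_le _).trans ?_
    calc ‖hφ.localizationOp F‖ₑ ≤ ‖F‖ₑ := by
          rw [← ofReal_norm, ← ofReal_norm]
          exact ENNReal.ofReal_le_ofReal (hφ.norm_localizationOp_le F)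
      _ = 1 * ‖F‖ₑ := (one_mul _).symm
      _ ≤ 4 * ‖F‖ₑ := by gcongr; norm_num
  have hq1 : 1 ≤ q.toReal := by simpa using ENNReal.toReal_mono hqt hq
  have hq' : 0 < q.toReal := one_pos.trans_le hq1
  refine schattenNorm_le_of_orthonormal hq hqt _ _ fun n u v hu hv => ?_
  set w : Fin n → Z → ℝ≥0∞ := fun j z => ‖inner ℂ (u j) (φ z)‖ₑ * ‖inner ℂ (φ z) (v j)‖ₑ with hw
  have hwm : ∀ j, Measurable (w j) := fun j =>
    (hφ.measurable_inner_right _).enorm.mul (hφ.measurable_inner_left _).enorm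
  have hw1 : ∀ z, ∑ j, w j z ≤ 1 := fun z => by
    have h := (tsum_inner_mul_inner_le hu hv (φ z) (φ z)).trans
      (mul_le_one' (hφ.enorm_le_one z) (hφ.enorm_le_one z))
    rw [tsum_fintype] at h
    refine le_trans (le_of_eq (Finset.sum_congr rfl fun j _ => ?_)) h
    simp only [hw]
    congr 1
    rw [← ofReal_norm, ← ofReal_norm, norm_inner_symm]
  have hw2 : ∀ j, ∫⁻ z, w j z ∂μ ≤ 1 := fun j => by
    refine (hφ.lintegral_inner_mul_inner_le (u j) (v j)).trans ?_
    rw [← ofReal_norm, ← ofReal_norm, hu.1, hv.1]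
    simp
  have hFm := (Lp.aestronglyMeasurable F).enorm
  calc ∑ j, ‖inner ℂ (u j) (hφ.localizationOp F (v j))‖ₑ ^ q.toReal
      ≤ ∑ j, ∫⁻ z, ‖F z‖ₑ ^ q.toReal * w j z ∂μ := by
        refine Finset.sum_le_sum fun j _ => ?_
        exact (ENNReal.rpow_le_rpow (hφ.enorm_inner_localizationOp_le F _ _) hq'.le).trans
          (lintegral_mul_rpow_le hq1 hFm (hwm j).aemeasurable (hw2 j))
    _ = ∫⁻ z, ‖F z‖ₑ ^ q.toReal * ∑ j, w j z ∂μ := by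
        simp only [Finset.mul_sum]
        exact (lintegral_finsetSum' _ fun j _ =>
          (hFm.pow_const _).mul (hwm j).aemeasurable).symm
    _ ≤ ∫⁻ z, ‖F z‖ₑ ^ q.toReal ∂μ := by
        refine lintegral_mono fun z => ?_
        calc _ ≤ ‖F z‖ₑ ^ q.toReal * 1 := by gcongr; exact hw1 z
          _ = _ := mul_one _
    _ = ‖F‖ₑ ^ q.toReal := by
        rw [Lp.enorm_def, eLpNorm_eq_lintegral_rpow_enorm_toReal (by positivity) hqt,
          ← ENNReal.rpow_mul, one_div_mul_cancel hq'.ne', ENNReal.rpow_one]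

/-- Localization operators with symbol in `L^q`, as a linear map into the Schatten class `𝒮^q`. -/
noncomputable def localizationOpₗ (hφ : IsCoherentFamily μ φ) :
    Lp ℂ q μ →ₗ[ℂ] schattenClass H q where
  toFun F := ⟨hφ.localizationOp F, (hφ.schattenNorm_localizationOp_le F).trans_lt
    (ENNReal.mul_lt_top (by simp) enorm_lt_top)⟩
  map_add' F G := by
    refine Subtype.ext (ContinuousLinearMap.ext fun f => ext_inner_left ℂ fun g => ?_)
    simp only [Submodule.coe_add, add_apply, inner_add_right,
      inner_localizationOp]
    rw [← integral_add (hφ.integrable_localization Fact.out (Lp.memLp F) g f)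
      (hφ.integrable_localization Fact.out (Lp.memLp G) g f)]
    refine integral_congr_ae ?_
    filter_upwards [Lp.coeFn_add F G] with z hz
    rw [hz, Pi.add_apply, add_mul]
  map_smul' c F := by
    refine Subtype.ext (ContinuousLinearMap.ext fun f => ext_inner_left ℂ fun g => ?_)
    simp only [RingHom.id_apply, Submodule.coe_smul, smul_apply,
      inner_smul_right, inner_localizationOp]
    rw [← integral_const_mul]
    refine integral_congr_ae ?_
    filter_upwards [Lp.coeFn_smul c F] with z hz
    rw [hz, Pi.smul_apply, smul_eq_mul, mul_assoc]

end Localization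

end IsCoherentFamily

end Coherent

/-! ### Algebra of the time-frequency shifts -/

section Shifts

variable {d : ℕ}

theorem symplecticForm_neg_left (z w : PhaseSpace d) :
    symplecticForm (-z) w = -symplecticForm z w := by
  simp only [symplecticForm, Prod.fst_neg, Prod.snd_neg, inner_neg_left, inner_neg_right]
  ring

theorem symplecticForm_neg_right (z w : PhaseSpace d) :
    symplecticForm z (-w) = -symplecticForm z w := by
  simp only [symplecticForm, Prod.fst_neg, Prod.snd_neg, inner_neg_left, inner_neg_right]
  ring

theorem symplecticForm_add_left (z z' w : PhaseSpace d) :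
    symplecticForm (z + z') w = symplecticForm z w + symplecticForm z' w := by
  simp only [symplecticForm, Prod.fst_add, Prod.snd_add, inner_add_left, inner_add_right]
  ring

theorem symplecticForm_swap (z w : PhaseSpace d) : symplecticForm z w = -symplecticForm w z := by
  simp only [symplecticForm]
  ring

@[fun_prop]
theorem Continuous.symplecticForm {X : Type*} [TopologicalSpace X] {f g : X → PhaseSpace d}
    (hf : Continuous f) (hg : Continuous g) : Continuous fun x => symplecticForm (f x) (g x) := by
  unfold _root_.symplecticForm
  fun_prop

theorem coeFn_timeFreqShift (z : PhaseSpace d) (f : L2Space d) :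
    timeFreqShift z f =ᵐ[volume] shiftFun z f := (memLp_shiftFun z f).coeFn_toLp

theorem shiftFun_congr_ae (z : PhaseSpace d) {f g : EuclideanSpace ℝ (Fin d) → ℂ}
    (h : f =ᵐ[volume] g) : shiftFun z f =ᵐ[volume] shiftFun z g := by
  filter_upwards [(measurePreserving_shift z).quasiMeasurePreserving.ae h] with t ht
  simp only [shiftFun, ht]

theorem shiftFun_shiftFun (z w : PhaseSpace d) (f : EuclideanSpace ℝ (Fin d) → ℂ)
    (t : EuclideanSpace ℝ (Fin d)) :
    shiftFun z (shiftFun w f) t =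
      Complex.exp (Real.pi * Complex.I * (symplecticForm z w : ℝ)) * shiftFun (z + w) f t := by
  simp only [shiftFun, symplecticForm, Prod.fst_add, Prod.snd_add, ← sub_sub, ← mul_assoc,
    ← Complex.exp_add]
  congr 2
  simp only [inner_add_left, inner_add_right, inner_sub_right, real_inner_comm]
  push_cast
  ring

theorem timeFreqShift_timeFreqShift (z w : PhaseSpace d) (f : L2Space d) :
    timeFreqShift z (timeFreqShift w f) =
      Complex.exp (Real.pi * Complex.I * (symplecticForm z w : ℝ)) • timeFreqShift (z + w) f := by
  refine Lp.ext ?_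
  filter_upwards [coeFn_timeFreqShift z (timeFreqShift w f),
    shiftFun_congr_ae z (coeFn_timeFreqShift w f), coeFn_timeFreqShift (z + w) f,
    Lp.coeFn_smul (Complex.exp (Real.pi * Complex.I * (symplecticForm z w : ℝ)))
      (timeFreqShift (z + w) f)] with t h1 h2 h3 h4
  rw [h1, h2, h4, Pi.smul_apply, h3, shiftFun_shiftFun, smul_eq_mul]

theorem timeFreqShift_zero (f : L2Space d) : timeFreqShift 0 f = f := by
  refine Lp.ext ?_
  filter_upwards [coeFn_timeFreqShift 0 f] with t h
  rw [h]
  simp [shiftFun]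

theorem timeFreqShift_comm (z w : PhaseSpace d) (f : L2Space d) :
    timeFreqShift z (timeFreqShift w f) =
      Complex.exp (2 * Real.pi * Complex.I * (symplecticForm z w : ℝ)) •
        timeFreqShift w (timeFreqShift z f) := by
  rw [timeFreqShift_timeFreqShift, timeFreqShift_timeFreqShift w z, smul_smul, ← Complex.exp_add,
    add_comm w z, symplecticForm_swap w z]
  congr 2
  push_cast
  ring

theorem inner_timeFreqShift_timeFreqShift (z : PhaseSpace d) (f g : L2Space d) :
    inner ℂ (timeFreqShift z f) (timeFreqShift z g) = inner ℂ f g :=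
  (timeFreqShiftₗᵢ z).inner_map_map f g

theorem norm_timeFreqShift (z : PhaseSpace d) (f : L2Space d) : ‖timeFreqShift z f‖ = ‖f‖ :=
  (timeFreqShiftₗᵢ z).norm_map f

theorem timeFreqShift_neg_right (z : PhaseSpace d) (f : L2Space d) :
    timeFreqShift z (timeFreqShift (-z) f) = f := by
  rw [timeFreqShift_timeFreqShift, add_neg_cancel, timeFreqShift_zero, symplecticForm_neg_right]
  simp [symplecticForm]

theorem inner_timeFreqShift_left (z : PhaseSpace d) (f g : L2Space d) :
    inner ℂ (timeFreqShift z f) g = inner ℂ f (timeFreqShift (-z) g) := by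
  conv_lhs => rw [← timeFreqShift_neg_right z g]
  exact inner_timeFreqShift_timeFreqShift z f _

theorem adjoint_timeFreqShift (z : PhaseSpace d) :
    ContinuousLinearMap.adjoint (timeFreqShift z) = timeFreqShift (-z) :=
  ContinuousLinearMap.ext fun f => ext_inner_left ℂ fun g => by
    rw [ContinuousLinearMap.adjoint_inner_right, inner_timeFreqShift_left]

end Shifts

/-! ### Moyal's identity for smooth functions -/

section Moyal

variable {d : ℕ}

/-- The voice transform `⟨ρ(z)χ, f⟩` of functions. -/
noncomputable def voiceTransform (χ f : EuclideanSpace ℝ (Fin d) → ℂ) (z : PhaseSpace d) : ℂ :=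
  ∫ t, (starRingEnd ℂ) (shiftFun z χ t) * f t

theorem continuous_shiftFun {χ : EuclideanSpace ℝ (Fin d) → ℂ} (hχ : Continuous χ) :
    Continuous fun p : PhaseSpace d × EuclideanSpace ℝ (Fin d) => shiftFun p.1 χ p.2 := by
  unfold shiftFun
  fun_prop

theorem stronglyMeasurable_voiceTransform {χ f : EuclideanSpace ℝ (Fin d) → ℂ}
    (hχ : Continuous χ) (hf : StronglyMeasurable f) :
    StronglyMeasurable (voiceTransform χ f) := by
  refine StronglyMeasurable.integral_prod_right'
    (f := fun p : PhaseSpace d × EuclideanSpace ℝ (Fin d) =>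
      (starRingEnd ℂ) (shiftFun p.1 χ p.2) * f p.2) ?_
  exact (Complex.continuous_conj.comp (continuous_shiftFun hχ)).stronglyMeasurable.mul
    (hf.comp_measurable measurable_snd)

/-- The product `t ↦ conj χ(t - x) f(t)` as a Schwartz function. -/
noncomputable def windowed {χ f : EuclideanSpace ℝ (Fin d) → ℂ} (hχ : ContDiff ℝ (⊤ : ℕ∞) χ)
    (hf : ContDiff ℝ (⊤ : ℕ∞) f) (hfc : HasCompactSupport f) (x : EuclideanSpace ℝ (Fin d)) :
    𝓢(EuclideanSpace ℝ (Fin d), ℂ) :=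
  HasCompactSupport.toSchwartzMap (f := fun t => (starRingEnd ℂ) (χ (t - x)) * f t) hfc.mul_left
    ((Complex.conjCLE.contDiff.comp (hχ.comp (contDiff_id.sub contDiff_const))).mul hf)

theorem windowed_apply {χ f : EuclideanSpace ℝ (Fin d) → ℂ} (hχ : ContDiff ℝ (⊤ : ℕ∞) χ)
    (hf : ContDiff ℝ (⊤ : ℕ∞) f) (hfc : HasCompactSupport f) (x t : EuclideanSpace ℝ (Fin d)) :
    windowed hχ hf hfc x t = (starRingEnd ℂ) (χ (t - x)) * f t := rfl

open FourierTransform in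
-- For fixed `x` the voice transform is, up to a unimodular factor, a Fourier transform in `ξ`,
-- which makes Plancherel available.
theorem voiceTransform_eq_fourier {χ f : EuclideanSpace ℝ (Fin d) → ℂ}
    (hχ : ContDiff ℝ (⊤ : ℕ∞) χ) (hf : ContDiff ℝ (⊤ : ℕ∞) f) (hfc : HasCompactSupport f)
    (x ξ : EuclideanSpace ℝ (Fin d)) :
    voiceTransform χ f (x, ξ) =
      Complex.exp (Real.pi * Complex.I * (inner ℝ x ξ : ℝ)) * (𝓕 (windowed hχ hf hfc x)) ξ := by
  rw [SchwartzMap.fourier_coe, Real.fourier_eq', voiceTransform, ← integral_const_mul]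
  congr 1 with t
  simp only [shiftFun, windowed_apply, smul_eq_mul, map_mul, ← Complex.exp_conj, ← mul_assoc]
  congr 2
  rw [← Complex.exp_add, ← Complex.exp_add]
  congr 1
  simp only [map_neg, map_mul, Complex.conj_ofReal, Complex.conj_I, Complex.conj_ofNat]
  push_cast
  rw [real_inner_comm t ξ]
  ring

open FourierTransform in
theorem SchwartzMap.lintegral_enorm_sq_fourier {V : Type*} [NormedAddCommGroup V]
    [InnerProductSpace ℝ V] [FiniteDimensional ℝ V] [MeasurableSpace V] [BorelSpace V]
    (h : 𝓢(V, ℂ)) : ∫⁻ ξ, ‖(𝓕 h) ξ‖ₑ ^ 2 = ∫⁻ x, ‖h x‖ₑ ^ 2 := by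
  have key : ∀ g : 𝓢(V, ℂ), ∫⁻ x, ‖g x‖ₑ ^ 2 = ENNReal.ofReal (∫ x, ‖g x‖ ^ 2) := fun g => by
    rw [ofReal_integral_eq_lintegral_ofReal
      ((g.memLp 2 volume).integrable_norm_pow (by norm_num))
      (Filter.Eventually.of_forall fun x => by positivity)]
    simp only [ENNReal.ofReal_pow (norm_nonneg _), ofReal_norm]
  rw [key, key, SchwartzMap.integral_norm_sq_fourier]

/-- Plancherel in `ξ`, then Tonelli and translation invariance in `x`. The function `f` is smooth
with compact support so that the windowed product is Schwartz; the window need only be smooth. -/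
theorem lintegral_enorm_sq_voiceTransform {χ f : EuclideanSpace ℝ (Fin d) → ℂ}
    (hχ : ContDiff ℝ (⊤ : ℕ∞) χ) (hf : ContDiff ℝ (⊤ : ℕ∞) f) (hfc : HasCompactSupport f) :
    ∫⁻ z, ‖voiceTransform χ f z‖ₑ ^ 2 = (∫⁻ t, ‖χ t‖ₑ ^ 2) * ∫⁻ t, ‖f t‖ₑ ^ 2 := by
  have hm := stronglyMeasurable_voiceTransform hχ.continuous hf.continuous.stronglyMeasurable
  rw [Measure.volume_eq_prod, lintegral_prod _ (hm.enorm.pow_const 2).aemeasurable]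
  have h1 : ∀ x, ∫⁻ ξ, ‖voiceTransform χ f (x, ξ)‖ₑ ^ 2 =
      ∫⁻ t, ‖χ (t - x)‖ₑ ^ 2 * ‖f t‖ₑ ^ 2 := fun x => by
    have h2 : ∀ ξ, ‖voiceTransform χ f (x, ξ)‖ₑ =
        ‖(FourierTransform.fourier (windowed hχ hf hfc x)) ξ‖ₑ := fun ξ => by
      rw [voiceTransform_eq_fourier hχ hf hfc, enorm_mul]
      rw [show ‖Complex.exp (Real.pi * Complex.I * (inner ℝ x ξ : ℝ))‖ₑ = 1 by
        rw [← ofReal_norm, Complex.norm_exp]; simp, one_mul]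
    simp only [h2]
    rw [SchwartzMap.lintegral_enorm_sq_fourier]
    simp only [windowed_apply, enorm_mul, mul_pow]
    simp only [← ofReal_norm, RCLike.norm_conj]
  simp only [h1]
  rw [lintegral_lintegral_swap]
  · have h3 : ∀ t, ∫⁻ x, ‖χ (t - x)‖ₑ ^ 2 * ‖f t‖ₑ ^ 2 = (∫⁻ x, ‖χ x‖ₑ ^ 2) * ‖f t‖ₑ ^ 2 :=
      fun t => by
        rw [lintegral_mul_const' _ _ (by finiteness),
          lintegral_sub_left_eq_self (fun x => ‖χ x‖ₑ ^ 2) t]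
    simp only [h3]
    rw [lintegral_const_mul]
    exact (hf.continuous.measurable.enorm).pow_const 2
  · have c1 : Continuous fun p : EuclideanSpace ℝ (Fin d) × EuclideanSpace ℝ (Fin d) =>
        χ (p.2 - p.1) := hχ.continuous.comp (by fun_prop)
    have c2 : Continuous fun p : EuclideanSpace ℝ (Fin d) × EuclideanSpace ℝ (Fin d) =>
        f p.2 := hf.continuous.comp (by fun_prop)
    exact ((c1.measurable.enorm.pow_const 2).mul (c2.measurable.enorm.pow_const 2)).aemeasurable

theorem memLp_voiceTransform {χ f : EuclideanSpace ℝ (Fin d) → ℂ}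
    (hχ : ContDiff ℝ (⊤ : ℕ∞) χ) (hχ2 : MemLp χ 2 volume) (hf : ContDiff ℝ (⊤ : ℕ∞) f)
    (hfc : HasCompactSupport f) : MemLp (voiceTransform χ f) 2 volume := by
  have hm := stronglyMeasurable_voiceTransform hχ.continuous hf.continuous.stronglyMeasurable
  refine ⟨hm.aestronglyMeasurable, ?_⟩
  have hf2 : MemLp f 2 (volume : Measure (EuclideanSpace ℝ (Fin d))) :=
    hf.continuous.memLp_of_hasCompactSupport hfc
  rw [eLpNorm_lt_top_iff_lintegral_rpow_enorm_lt_top (by norm_num) (by norm_num)] at *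
  have h1 := lintegral_rpow_enorm_lt_top_of_eLpNorm_lt_top (by norm_num) (by norm_num) hχ2.2
  have h2 := lintegral_rpow_enorm_lt_top_of_eLpNorm_lt_top (by norm_num) (by norm_num) hf2.2
  simp only [ENNReal.toReal_ofNat, ENNReal.rpow_ofNat] at *
  rw [lintegral_enorm_sq_voiceTransform hχ hf hfc]
  exact ENNReal.mul_lt_top h1 h2

/-- The polarized Moyal identity. Two different windows are allowed because a character of phase
space will later be absorbed by shifting one of them. -/
theorem integral_voiceTransform_mul {χ ψ f g : EuclideanSpace ℝ (Fin d) → ℂ}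
    (hχ : ContDiff ℝ (⊤ : ℕ∞) χ) (hχ2 : MemLp χ 2 volume)
    (hψ : ContDiff ℝ (⊤ : ℕ∞) ψ) (hψ2 : MemLp ψ 2 volume)
    (hf : ContDiff ℝ (⊤ : ℕ∞) f) (hfc : HasCompactSupport f)
    (hg : ContDiff ℝ (⊤ : ℕ∞) g) (hgc : HasCompactSupport g) :
    ∫ z, (starRingEnd ℂ) (voiceTransform χ g z) * voiceTransform ψ f z =
      (∫ t, (starRingEnd ℂ) (ψ t) * χ t) * ∫ t, (starRingEnd ℂ) (g t) * f t := by
  have hint : Integrable (fun z => (starRingEnd ℂ) (voiceTransform χ g z) * voiceTransform ψ f z)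
      (volume : Measure (PhaseSpace d)) :=
    (memLp_voiceTransform hχ hχ2 hg hgc).star.integrable_mul
      (memLp_voiceTransform hψ hψ2 hf hfc)
  rw [Measure.volume_eq_prod] at hint ⊢
  rw [integral_prod _ hint]
  have h1 : ∀ x, ∫ ξ, (starRingEnd ℂ) (voiceTransform χ g (x, ξ)) * voiceTransform ψ f (x, ξ) =
      ∫ t, ((starRingEnd ℂ) (ψ (t - x)) * χ (t - x)) * ((starRingEnd ℂ) (g t) * f t) := by
    intro x
    have h2 := SchwartzMap.integral_inner_fourier_fourier (windowed hχ hg hgc x)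
      (windowed hψ hf hfc x)
    simp only [RCLike.inner_apply, windowed_apply] at h2
    convert h2 using 2 with _ ξ ξ
    · funext ξ
      rw [voiceTransform_eq_fourier hχ hg hgc, voiceTransform_eq_fourier hψ hf hfc, map_mul,
        ← Complex.exp_conj]
      have : Complex.exp ((starRingEnd ℂ) (Real.pi * Complex.I * (inner ℝ x ξ : ℝ))) *
          Complex.exp (Real.pi * Complex.I * (inner ℝ x ξ : ℝ)) = 1 := by
        rw [← Complex.exp_add]
        simp
      linear_combination ((starRingEnd ℂ) ((FourierTransform.fourier (windowed hχ hg hgc x)) ξ) *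
        (FourierTransform.fourier (windowed hψ hf hfc x)) ξ) * this
    · funext t
      simp
      ring
  simp only [h1]
  have hi1 : Integrable (fun t => (starRingEnd ℂ) (ψ t) * χ t)
      (volume : Measure (EuclideanSpace ℝ (Fin d))) := hψ2.star.integrable_mul hχ2
  have hi2 : Integrable (fun t => (starRingEnd ℂ) (g t) * f t)
      (volume : Measure (EuclideanSpace ℝ (Fin d))) :=
    ((Complex.continuous_conj.comp hg.continuous).mul
      hf.continuous).integrable_of_hasCompactSupport hfc.mul_left
  rw [integral_integral_swap]
  · have h3 : ∀ t, ∫ x, ((starRingEnd ℂ) (ψ (t - x)) * χ (t - x)) * ((starRingEnd ℂ) (g t) * f t) =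
        (∫ x, (starRingEnd ℂ) (ψ x) * χ x) * ((starRingEnd ℂ) (g t) * f t) := fun t => by
      rw [integral_mul_const, integral_sub_left_eq_self (fun x => (starRingEnd ℂ) (ψ x) * χ x)]
    simp only [h3]
    rw [integral_const_mul]
  -- Fubini is justified by the measure-preserving shear `(x, t) ↦ (t - x, t)`, which turns the
  -- integrand into a product of two integrable functions.
  · have hshear : MeasurePreserving (fun p : EuclideanSpace ℝ (Fin d) × EuclideanSpace ℝ (Fin d) =>
        (p.2 - p.1, p.2)) (volume.prod volume) (volume.prod volume) := by
      have e1 := measurePreserving_add_prod (volume : Measure (EuclideanSpace ℝ (Fin d)))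
        (volume : Measure (EuclideanSpace ℝ (Fin d)))
      have e2 := (Measure.measurePreserving_neg
        (volume : Measure (EuclideanSpace ℝ (Fin d)))).prod
          (MeasurePreserving.id (volume : Measure (EuclideanSpace ℝ (Fin d))))
      convert! e1.comp e2 using 2 with p
      simp [sub_eq_neg_add]
    exact hshear.integrable_comp_of_integrable (hi1.mul_prod hi2)

end Moyal

/-! ### Gaussian coherent states -/

section Gaussian

variable {d : ℕ}

/-- The character `e^{-2πi σ(z, ζ)}` of phase space. -/
noncomputable def symplecticChar (z ζ : PhaseSpace d) : ℂ :=
  Complex.exp (-(2 * Real.pi * Complex.I * (symplecticForm z ζ : ℝ)))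

@[simp]
theorem norm_symplecticChar (z ζ : PhaseSpace d) : ‖symplecticChar z ζ‖ = 1 := by
  simp [symplecticChar, Complex.norm_exp]

@[simp]
theorem enorm_symplecticChar (z ζ : PhaseSpace d) : ‖symplecticChar z ζ‖ₑ = 1 := by
  rw [← ofReal_norm, norm_symplecticChar, ENNReal.ofReal_one]

theorem symplecticChar_neg_right (z ζ : PhaseSpace d) :
    symplecticChar z (-ζ) = symplecticChar ζ z := by
  rw [symplecticChar, symplecticChar, symplecticForm_neg_right, ← symplecticForm_swap]

theorem symplecticChar_add_left (z w ζ : PhaseSpace d) :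
    symplecticChar (z + w) ζ = symplecticChar z ζ * symplecticChar w ζ := by
  rw [symplecticChar, symplecticChar, symplecticChar, ← Complex.exp_add, symplecticForm_add_left]
  congr 1
  push_cast
  ring

@[fun_prop]
theorem Continuous.symplecticChar {X : Type*} [TopologicalSpace X] {f g : X → PhaseSpace d}
    (hf : Continuous f) (hg : Continuous g) : Continuous fun x => symplecticChar (f x) (g x) := by
  unfold _root_.symplecticChar
  fun_prop

/-- The `L^2`-normalized Gaussian `2^{d/4} e^{-π|t|²}`. -/
noncomputable def gaussianFun (d : ℕ) (t : EuclideanSpace ℝ (Fin d)) : ℂ :=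
  (((2 : ℝ) ^ ((d : ℝ) / 4) * Real.exp (-Real.pi * ‖t‖ ^ 2) : ℝ) : ℂ)

/-- The ambiguity function `e^{-π|w|²/2}` of the normalized Gaussian. -/
noncomputable def gaussianAmbiguity (w : PhaseSpace d) : ℝ :=
  Real.exp (-(Real.pi / 2) * (‖w.1‖ ^ 2 + ‖w.2‖ ^ 2))

theorem gaussianAmbiguity_pos (w : PhaseSpace d) : 0 < gaussianAmbiguity w := Real.exp_pos _

theorem gaussianAmbiguity_neg (w : PhaseSpace d) :
    gaussianAmbiguity (-w) = gaussianAmbiguity w := by simp [gaussianAmbiguity]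

theorem contDiff_gaussianAmbiguity :
    ContDiff ℝ (⊤ : ℕ∞) (gaussianAmbiguity : PhaseSpace d → ℝ) := by
  unfold gaussianAmbiguity
  exact Real.contDiff_exp.comp (contDiff_const.mul
    ((contDiff_fst.norm_sq ℝ).add (contDiff_snd.norm_sq ℝ)))

theorem contDiff_gaussianFun : ContDiff ℝ (⊤ : ℕ∞) (gaussianFun d) := by
  unfold gaussianFun
  exact Complex.ofRealCLM.contDiff.comp (contDiff_const.mul
    (Real.contDiff_exp.comp (contDiff_const.mul (contDiff_id.norm_sq ℝ))))

theorem memLp_gaussianFun : MemLp (gaussianFun d) 2 volume := by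
  rw [memLp_two_iff_integrable_sq_norm contDiff_gaussianFun.continuous.aestronglyMeasurable]
  have h := (GaussianFourier.integrable_cexp_neg_mul_sq_norm_add (b := 2 * Real.pi)
    (V := EuclideanSpace ℝ (Fin d)) (by simp [Real.pi_pos]) 0 0).norm.const_mul
    (((2 : ℝ) ^ ((d : ℝ) / 4)) ^ 2)
  refine h.congr (Filter.Eventually.of_forall fun t => ?_)
  simp only [gaussianFun, Complex.norm_real, Complex.norm_exp]
  rw [Real.norm_of_nonneg (by positivity), mul_pow, ← Real.exp_nat_mul]
  congr 2
  simp [← Complex.ofReal_pow]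
  ring

theorem integral_gaussianFun_mul_shiftFun (w : PhaseSpace d) :
    ∫ t, (starRingEnd ℂ) (gaussianFun d t) * shiftFun w (gaussianFun d) t =
      gaussianAmbiguity w := by
  obtain ⟨x, ξ⟩ := w
  -- Centring at `x / 2` lets the parallelogram law split off `|x|²`, and the phase `e^{-πi x·ξ}` of
  -- the symmetric shift cancels exactly.
  rw [← integral_add_right_eq_self _ ((1 / 2 : ℝ) • x)]
  have h1 : ∀ s : EuclideanSpace ℝ (Fin d),
      (starRingEnd ℂ) (gaussianFun d (s + (1 / 2 : ℝ) • x)) *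
        shiftFun (x, ξ) (gaussianFun d) (s + (1 / 2 : ℝ) • x) =
      ((((2 : ℝ) ^ ((d : ℝ) / 4)) ^ 2 * Real.exp (-(Real.pi / 2) * ‖x‖ ^ 2) : ℝ) : ℂ) *
        Complex.exp (-(2 * Real.pi) * ‖s‖ ^ 2 + 2 * Real.pi * Complex.I * (inner ℝ ξ s : ℝ)) := by
    intro s
    have e1 : s + (1 / 2 : ℝ) • x - x = s - (1 / 2 : ℝ) • x := by module
    have e2 : ‖s + (1 / 2 : ℝ) • x‖ ^ 2 + ‖s - (1 / 2 : ℝ) • x‖ ^ 2 =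
        2 * ‖s‖ ^ 2 + ‖x‖ ^ 2 / 2 := by
      have := parallelogram_law_with_norm ℝ s ((1 / 2 : ℝ) • x)
      rw [norm_smul] at this
      norm_num at this
      nlinarith
    simp only [shiftFun, gaussianFun, e1, Complex.conj_ofReal, inner_add_right, inner_smul_right]
    have e3 : (‖s + (1 / 2 : ℝ) • x‖ : ℂ) ^ 2 =
        2 * ‖s‖ ^ 2 + ‖x‖ ^ 2 / 2 - (‖s - (1 / 2 : ℝ) • x‖ : ℂ) ^ 2 := by
      exact_mod_cast eq_sub_of_add_eq e2
    push_cast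
    rw [e3, real_inner_comm ξ x]
    have e4 : ∀ a b c e f g : ℂ, a + b + c + e = f + g →
        Complex.exp a * (Complex.exp b * Complex.exp c * Complex.exp e) =
          Complex.exp f * Complex.exp g := by
      intro a b c e f g h
      rw [← Complex.exp_add, ← Complex.exp_add, ← Complex.exp_add, ← Complex.exp_add, ← h]
      congr 1
      ring
    have e5 := e4 (-Real.pi * (2 * ‖s‖ ^ 2 + ‖x‖ ^ 2 / 2 - (‖s - (1 / 2 : ℝ) • x‖ : ℂ) ^ 2))
      (-(Real.pi * Complex.I * (inner ℝ ξ x : ℝ)))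
      (2 * Real.pi * Complex.I * ((inner ℝ ξ s : ℝ) + 1 / 2 * (inner ℝ ξ x : ℝ)))
      (-Real.pi * (‖s - (1 / 2 : ℝ) • x‖ : ℂ) ^ 2) (-(Real.pi / 2) * ‖x‖ ^ 2)
      (-(2 * Real.pi) * ‖s‖ ^ 2 + 2 * Real.pi * Complex.I * (inner ℝ ξ s : ℝ)) (by ring)
    linear_combination (((2 : ℝ) ^ ((d : ℝ) / 4) : ℝ) : ℂ) ^ 2 * e5
  simp only [h1]
  rw [integral_const_mul, GaussianFourier.integral_cexp_neg_mul_sq_norm_add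
    (by simp [Real.pi_pos])]
  have hpi : (Real.pi : ℂ) ≠ 0 := by exact_mod_cast Real.pi_ne_zero
  have h2 : (Real.pi : ℂ) / (2 * Real.pi) = ((1 / 2 : ℝ) : ℂ) := by
    push_cast
    field_simp
  have h3 : (2 * Real.pi * Complex.I) ^ 2 * (‖ξ‖ : ℂ) ^ 2 / (4 * (2 * Real.pi)) =
      ((-(Real.pi / 2) * ‖ξ‖ ^ 2 : ℝ) : ℂ) := by
    push_cast
    rw [mul_pow, Complex.I_sq]
    field_simp
    norm_num
    ring
  have h4 : ((Module.finrank ℝ (EuclideanSpace ℝ (Fin d)) : ℂ)) / 2 = (((d : ℝ) / 2 : ℝ) : ℂ) := by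
    simp
  rw [h2, h3, h4, ← Complex.ofReal_cpow (by norm_num), ← Complex.ofReal_exp, ← Complex.ofReal_mul,
    ← Complex.ofReal_mul]
  congr 1
  rw [gaussianAmbiguity, mul_add, Real.exp_add]
  have h5 : ((2 : ℝ) ^ ((d : ℝ) / 4)) ^ 2 * (1 / 2 : ℝ) ^ ((d : ℝ) / 2) = 1 := by
    rw [← Real.rpow_natCast, ← Real.rpow_mul (by norm_num), one_div, Real.inv_rpow (by norm_num),
      show (d : ℝ) / 4 * (2 : ℕ) = d / 2 by push_cast; ring]
    exact mul_inv_cancel₀ (by positivity)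
  linear_combination (Real.exp (-(Real.pi / 2) * ‖x‖ ^ 2) * Real.exp (-(Real.pi / 2) * ‖ξ‖ ^ 2)) *
    h5

/-- The normalized Gaussian as an element of `L^2`. -/
noncomputable def gaussianWindow (d : ℕ) : L2Space d := memLp_gaussianFun.toLp (gaussianFun d)

/-- The coherent state `ρ(z)φ` with Gaussian `φ`. -/
noncomputable def coherentState (z : PhaseSpace d) : L2Space d :=
  timeFreqShift z (gaussianWindow d)

theorem coeFn_gaussianWindow : gaussianWindow d =ᵐ[volume] gaussianFun d :=
  memLp_gaussianFun.coeFn_toLp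

theorem inner_eq_integral_of_ae_eq {f g : L2Space d} {f' g' : EuclideanSpace ℝ (Fin d) → ℂ}
    (hf : f =ᵐ[volume] f') (hg : g =ᵐ[volume] g') :
    inner ℂ f g = ∫ t, (starRingEnd ℂ) (f' t) * g' t := by
  rw [L2.inner_def]
  refine integral_congr_ae ?_
  filter_upwards [hf, hg] with t h1 h2
  rw [h1, h2, RCLike.inner_apply, mul_comm]

theorem inner_gaussianWindow_timeFreqShift (w : PhaseSpace d) :
    inner ℂ (gaussianWindow d) (timeFreqShift w (gaussianWindow d)) = (gaussianAmbiguity w : ℂ) := by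
  rw [← integral_gaussianFun_mul_shiftFun]
  exact inner_eq_integral_of_ae_eq coeFn_gaussianWindow
    ((coeFn_timeFreqShift w _).trans (shiftFun_congr_ae w coeFn_gaussianWindow))

theorem inner_coherentState_timeFreqShift (z ζ : PhaseSpace d) :
    inner ℂ (coherentState z) (timeFreqShift ζ (coherentState z)) =
      symplecticChar z ζ * gaussianAmbiguity ζ := by
  rw [coherentState, timeFreqShift_comm, inner_smul_right, inner_timeFreqShift_timeFreqShift,
    inner_gaussianWindow_timeFreqShift, symplecticChar, symplecticForm_swap z ζ]
  congr 2
  push_cast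
  ring

theorem inner_coherentState_coherentState (z w : PhaseSpace d) :
    inner ℂ (coherentState z) (coherentState w) =
      Complex.exp (Real.pi * Complex.I * (symplecticForm (-z) w : ℝ)) *
        gaussianAmbiguity (-z + w) := by
  rw [coherentState, coherentState, inner_timeFreqShift_left, timeFreqShift_timeFreqShift,
    inner_smul_right, inner_gaussianWindow_timeFreqShift]

theorem norm_gaussianWindow : ‖gaussianWindow d‖ = 1 := by
  have h := inner_gaussianWindow_timeFreqShift (0 : PhaseSpace d)
  rw [timeFreqShift_zero, inner_self_eq_norm_sq_to_K] at h
  have h2 : ‖gaussianWindow d‖ ^ 2 = 1 := by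
    have : gaussianAmbiguity (0 : PhaseSpace d) = 1 := by simp [gaussianAmbiguity]
    rw [this] at h
    have h' : ((‖gaussianWindow d‖ ^ 2 : ℝ) : ℂ) = (1 : ℝ) := by
      rw [← h]
      push_cast
      rfl
    exact Complex.ofReal_injective h'
  exact (pow_eq_one_iff_of_nonneg (norm_nonneg _) two_ne_zero).1 h2

theorem norm_coherentState (z : PhaseSpace d) : ‖coherentState z‖ = 1 := by
  rw [coherentState, norm_timeFreqShift, norm_gaussianWindow]

/-- `‖φ_z - φ_w‖² = 2 - 2 Re ⟨φ_z, φ_w⟩`, and this inner product is explicit, so strong continuity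
of general shifts is not needed. -/
theorem continuous_coherentState : Continuous (coherentState : PhaseSpace d → L2Space d) := by
  rw [continuous_iff_continuousAt]
  intro w
  rw [ContinuousAt, tendsto_iff_norm_sub_tendsto_zero]
  have h1 : ∀ z, ‖coherentState z - coherentState w‖ =
      Real.sqrt (2 - 2 * (Complex.exp (Real.pi * Complex.I * (symplecticForm (-z) w : ℝ)) *
        gaussianAmbiguity (-z + w)).re) := fun z => by
    rw [← inner_coherentState_coherentState, ← Real.sqrt_sq (norm_nonneg (_ - _)),
      norm_sub_sq (𝕜 := ℂ), norm_coherentState, norm_coherentState]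
    congr 1
    simp only [RCLike.re_to_complex]
    ring
  have hG : Continuous (gaussianAmbiguity : PhaseSpace d → ℝ) :=
    contDiff_gaussianAmbiguity.continuous
  have h2 : Continuous fun z => ‖coherentState z - coherentState w‖ := by
    simp only [h1]
    fun_prop
  simpa using h2.tendsto w

theorem contDiff_shiftFun {f : EuclideanSpace ℝ (Fin d) → ℂ} (hf : ContDiff ℝ (⊤ : ℕ∞) f)
    (z : PhaseSpace d) : ContDiff ℝ (⊤ : ℕ∞) (shiftFun z f) := by
  unfold shiftFun
  refine (contDiff_const.mul ?_).mul (hf.comp (contDiff_id.sub contDiff_const))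
  exact Complex.contDiff_exp.comp (contDiff_const.mul
    (Complex.ofRealCLM.contDiff.comp (contDiff_const.inner ℝ contDiff_id)))

theorem hasCompactSupport_shiftFun {f : EuclideanSpace ℝ (Fin d) → ℂ} (hf : HasCompactSupport f)
    (z : PhaseSpace d) : HasCompactSupport (shiftFun z f) :=
  HasCompactSupport.mul_left (hf.comp_homeomorph (Homeomorph.subRight z.1))

theorem inner_timeFreqShift_eq_voiceTransform {χ f : L2Space d}
    {χ' f' : EuclideanSpace ℝ (Fin d) → ℂ} (hχ : χ =ᵐ[volume] χ') (hf : f =ᵐ[volume] f')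
    (z : PhaseSpace d) : inner ℂ (timeFreqShift z χ) f = voiceTransform χ' f' z :=
  inner_eq_integral_of_ae_eq ((coeFn_timeFreqShift z χ).trans (shiftFun_congr_ae z hχ)) hf

theorem lintegral_enorm_sq_eq {f : L2Space d} {f' : EuclideanSpace ℝ (Fin d) → ℂ}
    (hf : f =ᵐ[volume] f') : ∫⁻ t, ‖f' t‖ₑ ^ 2 = ‖f‖ₑ ^ 2 := by
  rw [Lp.enorm_def, eLpNorm_congr_ae hf,
    eLpNorm_eq_lintegral_rpow_enorm_toReal (by norm_num) (by norm_num)]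
  simp only [ENNReal.toReal_ofNat, ENNReal.rpow_ofNat]
  rw [← ENNReal.rpow_natCast, ← ENNReal.rpow_mul]
  norm_num

theorem isCoherentFamily_coherentState :
    IsCoherentFamily volume (coherentState : PhaseSpace d → L2Space d) where
  stronglyMeasurable := continuous_coherentState.stronglyMeasurable
  norm_le_one z := (norm_coherentState z).le
  lintegral_le f := by
    have hdense := Lp.dense_hasCompactSupport_contDiff (E := EuclideanSpace ℝ (Fin d)) (F := ℂ)
      (μ := volume) (p := 2) (by norm_num)
    obtain ⟨F, hF, hlim⟩ := mem_closure_iff_seq_limit.1 (hdense f)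
    have h1 : ∀ n, ∫⁻ z, ‖inner ℂ (coherentState z) (F n)‖ₑ ^ 2 = ‖F n‖ₑ ^ 2 := fun n => by
      obtain ⟨g, hFg, hgc, hg⟩ := hF n
      simp only [coherentState, inner_timeFreqShift_eq_voiceTransform coeFn_gaussianWindow hFg]
      rw [lintegral_enorm_sq_voiceTransform contDiff_gaussianFun hg hgc,
        lintegral_enorm_sq_eq hFg, lintegral_enorm_sq_eq coeFn_gaussianWindow, ← ofReal_norm,
        norm_gaussianWindow]
      simp
    have h2 : ∀ z, Filter.Tendsto (fun n => ‖inner ℂ (coherentState z) (F n)‖ₑ ^ 2) Filter.atTop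
        (nhds (‖inner ℂ (coherentState z) f‖ₑ ^ 2)) := fun z => by
      have h3 : Filter.Tendsto (fun n => inner ℂ (coherentState z) (F n)) Filter.atTop
        (nhds (inner ℂ (coherentState z) f)) := tendsto_const_nhds.inner hlim
      exact ((ENNReal.continuous_pow 2).tendsto _).comp ((continuous_enorm.tendsto _).comp h3)
    have h4 : Filter.Tendsto (fun n => ‖F n‖ₑ ^ 2) Filter.atTop (nhds (‖f‖ₑ ^ 2)) :=
      ((ENNReal.continuous_pow 2).tendsto _).comp ((continuous_enorm.tendsto _).comp hlim)
    -- Moyal gives equality on a dense set; Fatou's lemma extends the inequality, which is all that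
    -- is required.
    calc ∫⁻ z, ‖inner ℂ (coherentState z) f‖ₑ ^ 2
        = ∫⁻ z, Filter.liminf (fun n => ‖inner ℂ (coherentState z) (F n)‖ₑ ^ 2) Filter.atTop := by
          congr 1 with z
          exact (h2 z).liminf_eq.symm
      _ ≤ Filter.liminf (fun n => ∫⁻ z, ‖inner ℂ (coherentState z) (F n)‖ₑ ^ 2) Filter.atTop := by
          refine lintegral_liminf_le fun n => ?_
          exact (continuous_coherentState.inner continuous_const).measurable.enorm.pow_const 2
      _ = ‖f‖ₑ ^ 2 := by
          simp only [h1]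
          exact h4.liminf_eq

theorem memLp_symplecticChar (ζ : PhaseSpace d) :
    MemLp (fun z => symplecticChar z ζ) ∞ (volume : Measure (PhaseSpace d)) :=
  memLp_top_of_bound (by fun_prop : Continuous fun z => symplecticChar z ζ).aestronglyMeasurable 1
    (Filter.Eventually.of_forall fun z => (norm_symplecticChar z ζ).le)

theorem integrable_symplecticChar_mul_inner (ζ : PhaseSpace d) (g f : L2Space d) :
    Integrable (fun z => symplecticChar z ζ *
      (inner ℂ g (coherentState z) * inner ℂ (coherentState z) f)) volume :=
  isCoherentFamily_coherentState.integrable_localization (q := ∞) le_top (memLp_symplecticChar ζ)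
    g f

/-- The localization operator whose symbol is a character is a multiple of a time-frequency
shift. -/
theorem integral_symplecticChar_mul_inner (ζ : PhaseSpace d) (g f : L2Space d) :
    ∫ z, symplecticChar z ζ * (inner ℂ g (coherentState z) * inner ℂ (coherentState z) f) =
      gaussianAmbiguity ζ * inner ℂ g (timeFreqShift ζ f) := by
  -- Writing the integral as a matrix entry of a bounded operator makes it continuous in `f` and
  -- `g`, so it suffices to treat smooth compactly supported functions.
  set A := isCoherentFamily_coherentState.localizationOp ((memLp_symplecticChar ζ).toLp _)
  have hA : ∀ g f, inner ℂ g (A f) = ∫ z, symplecticChar z ζ *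
      (inner ℂ g (coherentState z) * inner ℂ (coherentState z) f) := fun g f => by
    rw [isCoherentFamily_coherentState.inner_localizationOp]
    refine integral_congr_ae ?_
    filter_upwards [(memLp_symplecticChar ζ).coeFn_toLp] with z hz
    rw [hz]
  have hdense := Lp.dense_hasCompactSupport_contDiff (E := EuclideanSpace ℝ (Fin d)) (F := ℂ)
    (μ := volume) (p := 2) (by norm_num)
  have key : ∀ g ∈ {f : L2Space d | ∃ g, f =ᵐ[volume] g ∧ HasCompactSupport g ∧
        ContDiff ℝ (⊤ : ℕ∞) g}, ∀ f ∈ {f : L2Space d | ∃ g, f =ᵐ[volume] g ∧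
        HasCompactSupport g ∧ ContDiff ℝ (⊤ : ℕ∞) g},
      inner ℂ g (A f) = gaussianAmbiguity ζ * inner ℂ g (timeFreqShift ζ f) := by
    rintro g ⟨g', hg, hgc, hgs⟩ f ⟨f', hf, hfc, hfs⟩
    have hf2 : timeFreqShift ζ f =ᵐ[volume] shiftFun ζ f' :=
      (coeFn_timeFreqShift ζ f).trans (shiftFun_congr_ae ζ hf)
    have hψ : timeFreqShift ζ (gaussianWindow d) =ᵐ[volume] shiftFun ζ (gaussianFun d) :=
      (coeFn_timeFreqShift ζ _).trans (shiftFun_congr_ae ζ coeFn_gaussianWindow)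
    -- The commutation relation gives `e^{-2πiσ(z,ζ)} ⟨φ_z, f⟩ = ⟨ρ(z)ρ(ζ)φ, ρ(ζ)f⟩`. So the
    -- character disappears once window and function are both shifted by `ζ`, and Moyal leaves the
    -- factor `⟨ρ(ζ)φ, φ⟩ = G(ζ)`.
    have h1 := integral_voiceTransform_mul contDiff_gaussianFun memLp_gaussianFun
      (contDiff_shiftFun contDiff_gaussianFun ζ)
      ((memLp_congr_ae hψ).1 (Lp.memLp (timeFreqShift ζ (gaussianWindow d))))
      (contDiff_shiftFun hfs ζ) (hasCompactSupport_shiftFun hfc ζ) hgs hgc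
    rw [← inner_eq_integral_of_ae_eq hψ coeFn_gaussianWindow,
      ← inner_eq_integral_of_ae_eq hg hf2, ← inner_conj_symm,
      inner_gaussianWindow_timeFreqShift, Complex.conj_ofReal] at h1
    rw [hA, ← h1]
    congr 1 with z
    rw [← inner_timeFreqShift_eq_voiceTransform coeFn_gaussianWindow hg,
      ← inner_timeFreqShift_eq_voiceTransform hψ hf2, inner_conj_symm,
      timeFreqShift_comm z ζ, inner_smul_left, inner_timeFreqShift_timeFreqShift,
      ← Complex.exp_conj, symplecticChar, coherentState]
    have : (starRingEnd ℂ) (2 * Real.pi * Complex.I * (symplecticForm z ζ : ℝ)) =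
        -(2 * Real.pi * Complex.I * (symplecticForm z ζ : ℝ)) := by
      simp only [map_mul, Complex.conj_ofReal, Complex.conj_I, Complex.conj_ofNat]
      ring
    rw [this]
    ring
  rw [← hA]
  have step : ∀ g ∈ {f : L2Space d | ∃ g, f =ᵐ[volume] g ∧ HasCompactSupport g ∧
        ContDiff ℝ (⊤ : ℕ∞) g}, ∀ f : L2Space d,
      inner ℂ g (A f) = gaussianAmbiguity ζ * inner ℂ g (timeFreqShift ζ f) := fun g hg f =>
    congrFun (Continuous.ext_on hdense
      (f := fun f => inner ℂ g (A f))
      (g := fun f => (gaussianAmbiguity ζ : ℂ) * inner ℂ g (timeFreqShift ζ f))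
      (by fun_prop) (by fun_prop) fun f hf => key g hg f hf) f
  exact congrFun (Continuous.ext_on hdense
      (f := fun g => inner ℂ g (A f))
      (g := fun g => (gaussianAmbiguity ζ : ℂ) * inner ℂ g (timeFreqShift ζ f))
      (by fun_prop) (by fun_prop) fun g hg => step g hg f) g

end Gaussian

/-! ### The symplectic Fourier transform -/

section SymplecticFourier

variable {d : ℕ}

theorem symplecticFourier_apply (f : PhaseSpace d → ℂ) (ζ : PhaseSpace d) :
    symplecticFourier f ζ = ∫ z, f z * symplecticChar ζ z := rfl

theorem integrable_mul_symplecticChar {f : PhaseSpace d → ℂ} (hf : Integrable f)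
    (ζ : PhaseSpace d) : Integrable fun z => f z * symplecticChar ζ z :=
  hf.mul_bdd (by fun_prop : Continuous fun z => symplecticChar ζ z).aestronglyMeasurable
    (Filter.Eventually.of_forall fun z => (norm_symplecticChar ζ z).le)

theorem norm_symplecticFourier_le (f : PhaseSpace d → ℂ) (ζ : PhaseSpace d) :
    ‖symplecticFourier f ζ‖ ≤ ∫ z, ‖f z‖ := by
  rw [symplecticFourier_apply]
  refine (norm_integral_le_integral_norm _).trans (le_of_eq ?_)
  simp

theorem continuous_symplecticFourier {f : PhaseSpace d → ℂ} (hf : Integrable f) :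
    Continuous (symplecticFourier f) := by
  refine continuous_of_dominated (bound := fun z => ‖f z‖)
    (fun ζ => (integrable_mul_symplecticChar hf ζ).1) (fun ζ => ?_) hf.norm ?_
  · exact Filter.Eventually.of_forall fun z => by
      have := norm_symplecticChar ζ z
      rw [symplecticChar] at this
      rw [norm_mul, this, mul_one]
  · exact Filter.Eventually.of_forall fun z =>
      continuous_const.mul (by fun_prop : Continuous fun ζ => symplecticChar ζ z)

theorem symplecticFourier_sub {f g : PhaseSpace d → ℂ} (hf : Integrable f) (hg : Integrable g)
    (ζ : PhaseSpace d) :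
    symplecticFourier (fun z => f z - g z) ζ = symplecticFourier f ζ - symplecticFourier g ζ := by
  simp only [symplecticFourier_apply]
  rw [← integral_sub (integrable_mul_symplecticChar hf ζ) (integrable_mul_symplecticChar hg ζ)]
  simp only [sub_mul]

/-- The linear equivalence `(x, ξ) ↦ (ξ, -x)` onto the Euclidean space `ℝ^{2d}`. -/
noncomputable def symplecticEquiv (d : ℕ) : PhaseSpace d ≃L[ℝ]
    WithLp 2 (EuclideanSpace ℝ (Fin d) × EuclideanSpace ℝ (Fin d)) :=
  (ContinuousLinearEquiv.prodComm ℝ (EuclideanSpace ℝ (Fin d)) (EuclideanSpace ℝ (Fin d))).trans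
    (((ContinuousLinearEquiv.refl ℝ (EuclideanSpace ℝ (Fin d))).prodCongr
      (ContinuousLinearEquiv.neg ℝ)).trans (WithLp.prodContinuousLinearEquiv 2 ℝ _ _).symm)

theorem symplecticEquiv_apply (ζ : PhaseSpace d) :
    symplecticEquiv d ζ = WithLp.toLp 2 (ζ.2, -ζ.1) := rfl

theorem measurePreserving_symplecticEquiv : MeasurePreserving (symplecticEquiv d) := by
  have h1 : MeasurePreserving (Prod.map id Neg.neg :
      PhaseSpace d → PhaseSpace d) volume volume :=
    (MeasurePreserving.id (volume : Measure (EuclideanSpace ℝ (Fin d)))).prod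
      (Measure.measurePreserving_neg (volume : Measure (EuclideanSpace ℝ (Fin d))))
  have h2 : MeasurePreserving (Prod.swap : PhaseSpace d → PhaseSpace d) volume volume :=
    Measure.measurePreserving_swap
  exact (WithLp.volume_preserving_toLp (EuclideanSpace ℝ (Fin d))
    (EuclideanSpace ℝ (Fin d))).comp (h1.comp h2)

/-- Identifies `ℱ_σ` with the ordinary Fourier transform followed by a measure-preserving linear
change of variables. The passage to `WithLp 2` is needed because the product carries no inner
product. -/
theorem inner_toLp_symplecticEquiv (z ζ : PhaseSpace d) :
    inner ℝ (WithLp.toLp 2 z) (symplecticEquiv d ζ) = symplecticForm ζ z := by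
  rw [symplecticEquiv_apply, WithLp.prod_inner_apply, symplecticForm, inner_neg_right,
    real_inner_comm z.2]
  ring

open FourierTransform

/-- The symplectic Fourier transform of a Schwartz function as a Schwartz function. -/
noncomputable def symplecticFourierSchwartz (Ψ : 𝓢(PhaseSpace d, ℂ)) : 𝓢(PhaseSpace d, ℂ) :=
  SchwartzMap.compCLMOfContinuousLinearEquiv ℂ (symplecticEquiv d)
    (𝓕 (SchwartzMap.compCLMOfContinuousLinearEquiv ℂ
      (WithLp.prodContinuousLinearEquiv 2 ℝ (EuclideanSpace ℝ (Fin d))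
        (EuclideanSpace ℝ (Fin d))) Ψ))

theorem coe_symplecticFourierSchwartz (Ψ : 𝓢(PhaseSpace d, ℂ)) :
    ⇑(symplecticFourierSchwartz Ψ) = symplecticFourier Ψ := by
  funext ζ
  rw [symplecticFourier_apply, symplecticFourierSchwartz,
    SchwartzMap.compCLMOfContinuousLinearEquiv_apply, Function.comp_apply,
    SchwartzMap.fourier_coe, Real.fourier_eq',
    ← (WithLp.volume_preserving_toLp (EuclideanSpace ℝ (Fin d))
      (EuclideanSpace ℝ (Fin d))).integral_comp
      (WithLp.prodContinuousLinearEquiv 2 ℝ (EuclideanSpace ℝ (Fin d))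
        (EuclideanSpace ℝ (Fin d))).symm.toHomeomorph.measurableEmbedding]
  congr 1 with z
  rw [inner_toLp_symplecticEquiv, smul_eq_mul, mul_comm, symplecticChar]
  congr 1
  congr 1
  push_cast
  ring

/-- Antisymmetry of `σ` supplies the sign that Fourier inversion requires, so `ℱ_σ` is its own
inverse. -/
theorem symplecticFourier_symplecticFourier (Ψ : 𝓢(PhaseSpace d, ℂ)) :
    symplecticFourier (symplecticFourier Ψ) = Ψ := by
  funext z
  set Φ := SchwartzMap.compCLMOfContinuousLinearEquiv ℂ
      (WithLp.prodContinuousLinearEquiv 2 ℝ (EuclideanSpace ℝ (Fin d))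
        (EuclideanSpace ℝ (Fin d))) Ψ with hΦ
  have h1 : (𝓕⁻ (𝓕 Φ)) (WithLp.toLp 2 z) = Ψ z := by
    rw [FourierTransform.fourierInv_fourier_eq, hΦ]
    rfl
  rw [← h1, SchwartzMap.fourierInv_coe, Real.fourierInv_eq',
    ← measurePreserving_symplecticEquiv.integral_comp
      (symplecticEquiv d).toHomeomorph.measurableEmbedding, symplecticFourier_apply,
    ← coe_symplecticFourierSchwartz]
  congr 1 with ζ
  rw [real_inner_comm, inner_toLp_symplecticEquiv, smul_eq_mul, mul_comm, symplecticChar,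
    symplecticForm_swap z ζ]
  congr 1
  congr 1
  push_cast
  ring

end SymplecticFourier

/-! ### Convolution on phase space -/

section Convolution

variable {d : ℕ}

instance instIsNegInvariantVolumePhaseSpace :
    (volume : Measure (PhaseSpace d)).IsNegInvariant :=
  Measure.IsAddHaarMeasure.isNegInvariant_of_regular _

/-- The convolution `∫ g(w) h(z - w) dw` on phase space. -/
noncomputable def phaseConv (g h : PhaseSpace d → ℂ) (z : PhaseSpace d) : ℂ :=
  ∫ w, g w * h (z - w)

theorem phaseConv_comm (g h : PhaseSpace d → ℂ) : phaseConv g h = phaseConv h g := by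
  funext z
  rw [phaseConv, ← integral_sub_left_eq_self _ _ z]
  simp only [sub_sub_cancel, mul_comm]
  rfl

theorem stronglyMeasurable_phaseConv {g h : PhaseSpace d → ℂ} (hg : StronglyMeasurable g)
    (hh : StronglyMeasurable h) : StronglyMeasurable (phaseConv g h) := by
  refine StronglyMeasurable.integral_prod_right'
    (f := fun p : PhaseSpace d × PhaseSpace d => g p.2 * h (p.1 - p.2)) ?_
  exact (hg.comp_measurable measurable_snd).mul
    (hh.comp_measurable (measurable_fst.sub measurable_snd))

/-- Young's inequality with `g` in `L^1`: after normalization `|g|` is a probability weight, and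
Jensen followed by translation invariance finishes. -/
theorem eLpNorm_phaseConv_le {p : ℝ≥0∞} (hp : 1 ≤ p) {g h : PhaseSpace d → ℂ}
    (hg : StronglyMeasurable g) (hgi : Integrable g) (hh : StronglyMeasurable h) :
    eLpNorm (phaseConv g h) p volume ≤ eLpNorm g 1 volume * eLpNorm h p volume := by
  rw [eLpNorm_one_eq_lintegral_enorm]
  set K := ∫⁻ w, ‖g w‖ₑ with hK
  have hKt : K ≠ ∞ := hgi.2.ne
  have hpt : ∀ z, ‖phaseConv g h z‖ₑ ≤ ∫⁻ w, ‖h (z - w)‖ₑ * ‖g w‖ₑ := fun z => by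
    refine (enorm_integral_le_lintegral_enorm _).trans (le_of_eq ?_)
    simp only [enorm_mul, mul_comm]
  by_cases hptop : p = ∞
  · subst hptop
    rw [eLpNorm_exponent_top, eLpNorm_exponent_top]
    refine eLpNormEssSup_le_of_ae_enorm_bound (Filter.Eventually.of_forall fun z => ?_)
    refine (hpt z).trans ?_
    have h1 : ∀ᵐ w, ‖h (z - w)‖ₑ ≤ eLpNormEssSup h volume :=
      (Measure.measurePreserving_sub_left volume z).quasiMeasurePreserving.ae
        (ae_le_eLpNormEssSup (f := h) (μ := volume))
    calc ∫⁻ w, ‖h (z - w)‖ₑ * ‖g w‖ₑ ≤ ∫⁻ w, eLpNormEssSup h volume * ‖g w‖ₑ := by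
          refine lintegral_mono_ae ?_
          filter_upwards [h1] with w hw
          gcongr
      _ = K * eLpNormEssSup h volume := by
          rw [lintegral_const_mul _ hg.enorm, mul_comm]
  rcases eq_or_ne K 0 with hK0 | hK0
  · have h1 : ∀ᵐ w, ‖g w‖ₑ = 0 := (lintegral_eq_zero_iff hg.enorm).1 hK0
    have h2 : phaseConv g h = 0 := by
      funext z
      refine integral_eq_zero_of_ae ?_
      filter_upwards [h1] with w hw
      rw [enorm_eq_zero.1 hw, zero_mul, Pi.zero_apply]
    simp [h2]
  have hp1 : 1 ≤ p.toReal := by simpa using ENNReal.toReal_mono hptop hp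
  have hp' : 0 < p.toReal := one_pos.trans_le hp1
  rw [eLpNorm_eq_lintegral_rpow_enorm_toReal (by positivity) hptop,
    eLpNorm_eq_lintegral_rpow_enorm_toReal (by positivity) hptop, one_div,
    ENNReal.rpow_inv_le_iff hp', ENNReal.mul_rpow_of_nonneg _ _ hp'.le, ← ENNReal.rpow_mul,
    inv_mul_cancel₀ hp'.ne', ENNReal.rpow_one]
  have hgK : Measurable fun w => ‖g w‖ₑ / K := hg.enorm.div_const K
  have hgK1 : ∫⁻ w, ‖g w‖ₑ / K = 1 := by
    simp only [div_eq_mul_inv]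
    rw [lintegral_mul_const _ hg.enorm, ← div_eq_mul_inv, ENNReal.div_self hK0 hKt]
  have hmeas : Measurable fun x : PhaseSpace d × PhaseSpace d => ‖h (x.1 - x.2)‖ₑ :=
    (hh.comp_measurable (measurable_fst.sub measurable_snd)).enorm
  have step : ∀ z, ‖phaseConv g h z‖ₑ ^ p.toReal ≤
      K ^ p.toReal * ∫⁻ w, ‖h (z - w)‖ₑ ^ p.toReal * (‖g w‖ₑ / K) := fun z => by
    have hz : Measurable fun w => ‖h (z - w)‖ₑ := hmeas.comp measurable_prodMk_left
    have h3 : ‖phaseConv g h z‖ₑ ≤ K * ∫⁻ w, ‖h (z - w)‖ₑ * (‖g w‖ₑ / K) := by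
      refine (hpt z).trans (le_of_eq ?_)
      rw [← lintegral_const_mul' _ _ hKt]
      congr 1 with w
      rw [mul_left_comm, ENNReal.mul_div_cancel hK0 hKt]
    refine (ENNReal.rpow_le_rpow h3 hp'.le).trans ?_
    rw [ENNReal.mul_rpow_of_nonneg _ _ hp'.le]
    gcongr
    exact lintegral_mul_rpow_le hp1 hz.aemeasurable hgK.aemeasurable hgK1.le
  refine (lintegral_mono step).trans (le_of_eq ?_)
  have hm2 : Measurable fun x : PhaseSpace d × PhaseSpace d =>
      ‖h (x.1 - x.2)‖ₑ ^ p.toReal * (‖g x.2‖ₑ / K) :=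
    (hmeas.pow_const _).mul (hgK.comp measurable_snd)
  rw [lintegral_const_mul _ hm2.lintegral_prod_right, lintegral_lintegral_swap hm2.aemeasurable]
  congr 1
  have h4 : ∀ w, ∫⁻ z, ‖h (z - w)‖ₑ ^ p.toReal * (‖g w‖ₑ / K) =
      (∫⁻ z, ‖h z‖ₑ ^ p.toReal) * (‖g w‖ₑ / K) := fun w => by
    rw [lintegral_mul_const' _ _ (ENNReal.div_ne_top enorm_ne_top hK0),
      lintegral_sub_right_eq_self (fun z => ‖h z‖ₑ ^ p.toReal) w]
  simp only [h4]
  rw [lintegral_const_mul _ hgK, hgK1, mul_one]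

/-- Pure Fubini, with no inversion formula, hence valid for merely integrable `g` and `k`. -/
theorem phaseConv_symplecticFourier {g k : PhaseSpace d → ℂ} (hg : Integrable g)
    (hk : Integrable k) (z : PhaseSpace d) :
    phaseConv g (symplecticFourier k) z =
      ∫ ζ, k ζ * symplecticFourier g ζ * symplecticChar z ζ := by
  have h1 : ∀ w, g w * symplecticFourier k (z - w) =
      ∫ ζ, (g w * k ζ) * (symplecticChar z ζ * symplecticChar ζ w) := fun w => by
    rw [symplecticFourier_apply, ← integral_const_mul]
    congr 1 with ζ
    rw [sub_eq_add_neg, symplecticChar_add_left]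
    have : symplecticChar (-w) ζ = symplecticChar ζ w := by
      rw [symplecticChar, symplecticChar, symplecticForm_neg_left, ← symplecticForm_swap]
    rw [this]
    ring
  rw [phaseConv]
  simp only [h1]
  rw [integral_integral_swap]
  · congr 1 with ζ
    rw [symplecticFourier_apply, ← integral_const_mul, ← integral_mul_const]
    congr 1 with w
    ring
  · refine (hg.mul_prod hk).mul_bdd (c := 1) (Continuous.aestronglyMeasurable ?_) ?_
    · exact (by fun_prop : Continuous fun p : PhaseSpace d × PhaseSpace d =>
        symplecticChar z p.2 * symplecticChar p.2 p.1)
    · exact Filter.Eventually.of_forall fun p => by simp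

end Convolution

/-! ### Traces and the Fourier–Wigner transform -/

section Trace

/-- Distinct vectors are at distance `√2`, so the balls of radius `1/2` are disjoint. Countability
of the basis defining the trace permits exchanging its sum with integrals. -/
theorem Orthonormal.countable {ι H : Type*} [NormedAddCommGroup H] [InnerProductSpace ℂ H]
    [TopologicalSpace.SeparableSpace H] {v : ι → H} (hv : Orthonormal ℂ v) : Countable ι := by
  rw [← Set.countable_univ_iff]
  refine Set.PairwiseDisjoint.countable_of_isOpen (s := fun i => Metric.ball (v i) (1 / 2)) ?_
    (fun i _ => Metric.isOpen_ball) fun i _ => Metric.nonempty_ball.2 (by norm_num)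
  intro i _ j _ hij
  refine Metric.ball_disjoint_ball ?_
  have h := norm_sub_sq (𝕜 := ℂ) (v i) (v j)
  rw [hv.2 hij, hv.1, hv.1] at h
  simp only [map_zero] at h
  rw [dist_eq_norm]
  nlinarith [norm_nonneg (v i - v j)]

/-- Frees the trace from the basis chosen in its definition: absolute convergence allows the sums to
be exchanged, and Parseval evaluates the sum over the basis. -/
theorem operatorTrace_eq_tsum {H : Type*} [NormedAddCommGroup H] [InnerProductSpace ℂ H]
    [CompleteSpace H] {J : Type*} {S : H →L[ℂ] H} {c : J → ℂ} {u v : J → H}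
    (hc : ∑' j, ‖c j‖ₑ ≠ ∞) (hu : ∀ j, ‖u j‖ ≤ 1) (hv : ∀ j, ‖v j‖ ≤ 1)
    (hS : ∀ x, HasSum (fun j => (c j * inner ℂ (v j) x) • u j) (S x)) :
    operatorTrace S = ∑' j, c j * inner ℂ (v j) (u j) := by
  rw [operatorTrace]
  set b := (exists_hilbertBasis ℂ H).choose_spec.choose
  have h1 : ∀ e, inner ℂ (b e) (S (b e)) =
      ∑' j, c j * (inner ℂ (v j) (b e) * inner ℂ (b e) (u j)) := fun e => by
    have h2 := (hS (b e)).mapL (innerSL ℂ (b e))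
    simp only [innerSL_apply_apply, inner_smul_right] at h2
    rw [← h2.tsum_eq]
    simp only [mul_assoc]
  simp only [h1]
  have hswap : ∀ x y : H, ‖inner ℂ x y‖ₑ = ‖inner ℂ y x‖ₑ := fun x y => by
    rw [← ofReal_norm, ← ofReal_norm, norm_inner_symm]
  rw [Summable.tsum_comm]
  · congr 1 with j
    rw [tsum_mul_left, b.tsum_inner_mul_inner]
  · refine Summable.of_enorm (ne_top_of_le_ne_top hc ?_)
    rw [ENNReal.tsum_prod']
    refine ENNReal.tsum_le_tsum fun j => ?_
    simp only [Function.uncurry, enorm_mul]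
    rw [ENNReal.tsum_mul_left]
    calc ‖c j‖ₑ * ∑' e, ‖inner ℂ (v j) (b e)‖ₑ * ‖inner ℂ (b e) (u j)‖ₑ
        ≤ ‖c j‖ₑ * (‖v j‖ₑ * ‖u j‖ₑ) := by
          gcongr
          simp only [hswap (v j)]
          exact tsum_inner_mul_inner_le b.orthonormal b.orthonormal _ _
      _ ≤ ‖c j‖ₑ * (1 * 1) := by
          gcongr
          · rw [← ofReal_norm, ← ENNReal.ofReal_one]
            exact ENNReal.ofReal_le_ofReal (hv j)
          · rw [← ofReal_norm, ← ENNReal.ofReal_one]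
            exact ENNReal.ofReal_le_ofReal (hu j)
      _ = ‖c j‖ₑ := by simp

end Trace

/-! ### Lower symbols and localization operators on the Fourier side. -/

section FourierWigner

variable {d : ℕ}

theorem conj_symplecticChar (z ζ : PhaseSpace d) :
    (starRingEnd ℂ) (symplecticChar z ζ) = symplecticChar ζ z := by
  rw [symplecticChar, symplecticChar, ← Complex.exp_conj, symplecticForm_swap z ζ]
  congr 1
  simp only [map_neg, map_mul, Complex.conj_ofReal, Complex.conj_I, Complex.conj_ofNat]
  push_cast
  ring

theorem integrable_lowerSymbol {T : L2Space d →L[ℂ] L2Space d} (hT : schattenNorm 1 T < ∞) :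
    Integrable (lowerSymbol coherentState T) volume := by
  rw [← memLp_one_iff_integrable]
  exact ⟨(isCoherentFamily_coherentState.stronglyMeasurable_lowerSymbol T).aestronglyMeasurable,
    (isCoherentFamily_coherentState.eLpNorm_lowerSymbol_le le_rfl T).trans_lt hT⟩

/-- By linearity in the Schmidt decomposition it suffices to treat rank one terms. For these the
integral against the character is `G(ζ) ⟨v_j, ρ(-ζ)u_j⟩ = G(ζ) ⟨ρ(ζ)v_j, u_j⟩`, the trace of the
term times `ρ(ζ)*`. -/
theorem symplecticFourier_lowerSymbol {T : L2Space d →L[ℂ] L2Space d}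
    (hT : schattenNorm 1 T < ∞) (ζ : PhaseSpace d) :
    symplecticFourier (lowerSymbol coherentState T) ζ =
      gaussianAmbiguity ζ * fourierWigner T ζ := by
  obtain ⟨J, _, t, u, v, hu, hv, -, hsum, ht⟩ :=
    exists_schmidt_decomposition one_ne_zero ENNReal.one_ne_top hT
  have ht' : ∑' j, ‖(t j : ℂ)‖ₑ ≠ ∞ := by
    have h : ∀ j, ‖(t j : ℂ)‖ₑ = ‖t j‖ₑ := fun j => by
      rw [← ofReal_norm, ← ofReal_norm, Complex.norm_real]
    simp only [ENNReal.toReal_one, ENNReal.rpow_one] at ht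
    simp only [h]
    exact (ht.trans_lt hT).ne
  have hFW : fourierWigner T ζ = ∑' j, (t j : ℂ) * inner ℂ (timeFreqShift ζ (v j)) (u j) := by
    refine operatorTrace_eq_tsum ht' (fun j => (hu.1 j).le)
      (fun j => (norm_timeFreqShift ζ (v j)).trans_le (hv.1 j).le) fun x => ?_
    have h := hsum (ContinuousLinearMap.adjoint (timeFreqShift ζ) x)
    simp only [ContinuousLinearMap.adjoint_inner_right] at h
    exact h
  set F : J → PhaseSpace d → ℂ := fun j z => (t j : ℂ) * (symplecticChar z (-ζ) *
    (inner ℂ (v j) (coherentState z) * inner ℂ (coherentState z) (u j))) with hF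
  have hFint : ∀ j, Integrable (F j) volume := fun j =>
    (integrable_symplecticChar_mul_inner (-ζ) (v j) (u j)).const_mul _
  have hFl : ∀ j, ∫⁻ z, ‖F j z‖ₑ ≤ ‖(t j : ℂ)‖ₑ := fun j => by
    simp only [hF, enorm_mul, enorm_symplecticChar, one_mul]
    rw [lintegral_const_mul' _ _ enorm_ne_top]
    have h := isCoherentFamily_coherentState.lintegral_inner_mul_inner_le (v j) (u j)
    rw [← ofReal_norm (v j), ← ofReal_norm (u j), hv.1, hu.1, ENNReal.ofReal_one, one_mul] at h
    calc _ ≤ ‖(t j : ℂ)‖ₑ * 1 := by gcongr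
      _ = _ := mul_one _
  have hsummable : Summable fun j => ∫ z, ‖F j z‖ := by
    have h := ENNReal.summable_toReal (ne_top_of_le_ne_top ht' (ENNReal.tsum_le_tsum hFl))
    refine h.congr fun j => ?_
    rw [integral_norm_eq_lintegral_enorm (hFint j).1]
  have h1 := hasSum_integral_of_summable_integral_norm hFint hsummable
  have h2 : ∀ z, ∑' j, F j z = lowerSymbol coherentState T z * symplecticChar ζ z := fun z => by
    have h3 := (hsum (coherentState z)).mapL (innerSL ℂ (coherentState z))
    simp only [innerSL_apply_apply, inner_smul_right] at h3
    rw [lowerSymbol, ← (h3.mul_right _).tsum_eq]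
    congr 1 with j
    simp only [hF, symplecticChar_neg_right]
    ring
  simp only [h2] at h1
  rw [symplecticFourier_apply, ← h1.tsum_eq, hFW, ← tsum_mul_left]
  congr 1 with j
  simp only [hF]
  rw [integral_const_mul, integral_symplecticChar_mul_inner, gaussianAmbiguity_neg,
    inner_timeFreqShift_left]
  ring

/-- Taking the trace inside the integral leaves `⟨ρ(ζ)φ_z, φ_z⟩`, which is a character times `G(ζ)`.
Integrability of `F` is what justifies the exchange. -/
theorem fourierWigner_localizationOp {q : ℝ≥0∞} [Fact (1 ≤ q)]
    (F : Lp ℂ q (volume : Measure (PhaseSpace d))) (hF : Integrable F volume)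
    (ζ : PhaseSpace d) :
    fourierWigner (isCoherentFamily_coherentState.localizationOp F) ζ =
      gaussianAmbiguity ζ * symplecticFourier F ζ := by
  rw [fourierWigner, operatorTrace]
  set b := (exists_hilbertBasis ℂ (L2Space d)).choose_spec.choose
  have : Fact ((2 : ℝ≥0∞) ≠ ∞) := ⟨by norm_num⟩
  have : Countable (exists_hilbertBasis ℂ (L2Space d)).choose := b.orthonormal.countable
  set f : (exists_hilbertBasis ℂ (L2Space d)).choose → PhaseSpace d → ℂ := fun e z =>
    F z * (inner ℂ (b e) (coherentState z) *
      inner ℂ (coherentState z) (timeFreqShift (-ζ) (b e))) with hf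
  have h1 : ∀ e, inner ℂ (b e) ((isCoherentFamily_coherentState.localizationOp F ∘L
      ContinuousLinearMap.adjoint (timeFreqShift ζ)) (b e)) = ∫ z, f e z := fun e => by
    rw [ContinuousLinearMap.comp_apply, adjoint_timeFreqShift,
      isCoherentFamily_coherentState.inner_localizationOp]
  have hfint : ∀ e, Integrable (f e) volume := fun e =>
    isCoherentFamily_coherentState.integrable_localization Fact.out (Lp.memLp F) _ _
  have hfl : ∀ z, ∑' e, ‖f e z‖ₑ ≤ ‖F z‖ₑ := fun z => by
    simp only [hf, enorm_mul]
    rw [ENNReal.tsum_mul_left]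
    calc _ ≤ ‖F z‖ₑ * (‖coherentState z‖ₑ * ‖timeFreqShift ζ (coherentState z)‖ₑ) := by
          gcongr
          refine le_trans (le_of_eq ?_) (tsum_inner_mul_inner_le b.orthonormal b.orthonormal _ _)
          congr 1 with e
          rw [← inner_timeFreqShift_left]
          congr 1
          rw [← ofReal_norm, ← ofReal_norm, norm_inner_symm]
      _ = ‖F z‖ₑ := by
          rw [← ofReal_norm (coherentState z), ← ofReal_norm (timeFreqShift ζ _),
            norm_timeFreqShift, norm_coherentState]
          simp
  have hsummable : Summable fun e => ∫ z, ‖f e z‖ := by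
    have h2 : ∑' e, ∫⁻ z, ‖f e z‖ₑ ≠ ∞ := by
      rw [← lintegral_tsum fun e => (hfint e).1.enorm]
      exact ((lintegral_mono hfl).trans_lt hF.2).ne
    refine (ENNReal.summable_toReal h2).congr fun e => ?_
    rw [integral_norm_eq_lintegral_enorm (hfint e).1]
  have h3 := (hasSum_integral_of_summable_integral_norm hfint hsummable).tsum_eq
  refine (tsum_congr h1).trans (h3.trans ?_)
  rw [symplecticFourier_apply, ← integral_const_mul]
  congr 1 with z
  have h4 : ∀ e, f e z = F z * (inner ℂ (timeFreqShift ζ (coherentState z)) (b e) *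
      inner ℂ (b e) (coherentState z)) := fun e => by
    simp only [hf]
    rw [inner_timeFreqShift_left]
    ring
  simp only [h4]
  rw [tsum_mul_left, b.tsum_inner_mul_inner, ← inner_conj_symm, inner_coherentState_timeFreqShift,
    map_mul, conj_symplecticChar, Complex.conj_ofReal]
  ring

/-- Works for any bounded weak integral, so it applies to the value of a multiplier, which need not
be trace class. -/
theorem lowerSymbol_eq_symplecticFourier {K : PhaseSpace d → ℂ}
    {B : L2Space d →L[ℂ] L2Space d} (h : IsWeakShiftIntegral K B) :
    lowerSymbol coherentState B = symplecticFourier fun ζ => K ζ * gaussianAmbiguity ζ := by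
  funext z
  rw [lowerSymbol, (h _ _).2, symplecticFourier_apply]
  congr 1 with ζ
  rw [inner_coherentState_timeFreqShift]
  ring

/-- Fubini reduces the symbol `ℱ_σ(k)` to its characters, each of which localizes to `G(ζ) ρ(ζ)`. -/
theorem isWeakShiftIntegral_localizationOp {q : ℝ≥0∞} [Fact (1 ≤ q)] {k : PhaseSpace d → ℂ}
    (hk : Integrable k) {F : Lp ℂ q (volume : Measure (PhaseSpace d))}
    (hF : F =ᵐ[volume] symplecticFourier k) :
    IsWeakShiftIntegral (fun ζ => k ζ * gaussianAmbiguity ζ)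
      (isCoherentFamily_coherentState.localizationOp F) := by
  intro f g
  have hi : Integrable (fun z : PhaseSpace d =>
      inner ℂ g (coherentState z) * inner ℂ (coherentState z) f) := by
    simpa [symplecticChar, symplecticForm] using integrable_symplecticChar_mul_inner 0 g f
  have hprod : Integrable (Function.uncurry fun z ζ : PhaseSpace d => (k ζ * symplecticChar z ζ) *
      (inner ℂ g (coherentState z) * inner ℂ (coherentState z) f)) (volume.prod volume) := by
    have h1 := (hi.mul_prod hk).mul_bdd (c := 1)
      (g := fun p : PhaseSpace d × PhaseSpace d => symplecticChar p.1 p.2)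
      (Continuous.aestronglyMeasurable (by fun_prop))
      (Filter.Eventually.of_forall fun p => by simp)
    refine h1.congr (Filter.Eventually.of_forall fun p => ?_)
    simp only [Function.uncurry]
    ring
  have hinner : ∀ ζ, ∫ z, (k ζ * symplecticChar z ζ) *
      (inner ℂ g (coherentState z) * inner ℂ (coherentState z) f) =
      k ζ * gaussianAmbiguity ζ * inner ℂ g (timeFreqShift ζ f) := fun ζ => by
    simp only [mul_assoc (k ζ)]
    rw [integral_const_mul, integral_symplecticChar_mul_inner]
  constructor
  · have h2 := hprod.integral_prod_right
    simpa only [Function.uncurry, hinner] using h2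
  · rw [isCoherentFamily_coherentState.inner_localizationOp]
    simp only [← hinner]
    rw [← integral_integral_swap hprod]
    refine integral_congr_ae ?_
    filter_upwards [hF] with z hz
    rw [hz, symplecticFourier_apply, integral_mul_const]

theorem IsWeakShiftIntegral.congr_ae {K K' : PhaseSpace d → ℂ}
    {B : L2Space d →L[ℂ] L2Space d} (h : IsWeakShiftIntegral K B) (hK : K =ᵐ[volume] K') :
    IsWeakShiftIntegral K' B := by
  intro f g
  have h1 : (fun z => K z * inner ℂ g (timeFreqShift z f)) =ᵐ[volume]
      fun z => K' z * inner ℂ g (timeFreqShift z f) := by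
    filter_upwards [hK] with z hz
    rw [hz]
  exact ⟨(h f g).1.congr h1, (h f g).2.trans (integral_congr_ae h1)⟩

end FourierWigner

/-! ### Transference between classical and Fourier–Wigner multipliers -/

section Transference

variable {d : ℕ}

/-- A smooth cutoff divided by `G²`, which is smooth and never zero. -/
theorem exists_schwartz_mul_gaussianAmbiguity_sq_eq_one {Ω : Set (PhaseSpace d)}
    (hΩ : IsCompact Ω) :
    ∃ b : 𝓢(PhaseSpace d, ℂ), ∀ ζ ∈ Ω, b ζ * (gaussianAmbiguity ζ : ℂ) ^ 2 = 1 := by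
  obtain ⟨R, hR0, hR⟩ := hΩ.isBounded.subset_closedBall_lt 0 0
  let χ : ContDiffBump (0 : PhaseSpace d) := ⟨R, R + 1, hR0, by linarith⟩
  let β : PhaseSpace d → ℝ := fun ζ => χ ζ * (gaussianAmbiguity ζ ^ 2)⁻¹
  have hβ : ContDiff ℝ (⊤ : ℕ∞) β := χ.contDiff.mul
    ((contDiff_gaussianAmbiguity.pow 2).inv fun ζ => (pow_pos (gaussianAmbiguity_pos ζ) 2).ne')
  have hβc : HasCompactSupport β := χ.hasCompactSupport.mul_right
  have h1 : HasCompactSupport fun ζ => (β ζ : ℂ) :=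
    hβc.comp_left (g := fun x : ℝ => (x : ℂ)) Complex.ofReal_zero
  refine ⟨h1.toSchwartzMap (Complex.ofRealCLM.contDiff.comp hβ), fun ζ hζ => ?_⟩
  have h2 : χ ζ = 1 := χ.one_of_mem_closedBall (hR hζ)
  have h3 : β ζ * gaussianAmbiguity ζ ^ 2 = 1 := by
    simp only [β, h2, one_mul]
    exact inv_mul_cancel₀ (pow_pos (gaussianAmbiguity_pos ζ) 2).ne'
  change (β ζ : ℂ) * (gaussianAmbiguity ζ : ℂ) ^ 2 = 1
  exact_mod_cast h3

theorem gaussianAmbiguity_le_one (ζ : PhaseSpace d) : gaussianAmbiguity ζ ≤ 1 := by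
  rw [gaussianAmbiguity, Real.exp_le_one_iff]
  have : 0 ≤ Real.pi / 2 * (‖ζ.1‖ ^ 2 + ‖ζ.2‖ ^ 2) := by positivity
  linarith

theorem integrable_of_memLp_top_of_ae_eq_zero {Ω : Set (PhaseSpace d)} (hΩ : IsCompact Ω)
    {m : PhaseSpace d → ℂ} (hm : MemLp m ∞ volume) (h0 : ∀ᵐ z, z ∉ Ω → m z = 0) :
    Integrable m := by
  have : IsFiniteMeasure ((volume : Measure (PhaseSpace d)).restrict Ω) :=
    ⟨by simpa using hΩ.measure_lt_top⟩
  have h1 : IntegrableOn m Ω volume := (hm.restrict Ω).integrable le_top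
  refine ((integrable_indicator_iff hΩ.measurableSet).2 h1).congr ?_
  filter_upwards [h0] with z hz
  by_cases hzΩ : z ∈ Ω
  · simp [hzΩ]
  · simp [hzΩ, hz hzΩ]

theorem integrable_mul_symplecticFourier {m f : PhaseSpace d → ℂ} (hm : Integrable m)
    (hf : Integrable f) : Integrable fun ζ => m ζ * symplecticFourier f ζ :=
  hm.mul_bdd (continuous_symplecticFourier hf).aestronglyMeasurable
    (Filter.Eventually.of_forall (norm_symplecticFourier_le f))

theorem SchwartzMap.exists_norm_le (b : 𝓢(PhaseSpace d, ℂ)) : ∃ C, ∀ ζ, ‖b ζ‖ ≤ C := by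
  obtain ⟨C, -, hC⟩ := b.decay 0 0
  exact ⟨C, fun ζ => by simpa using hC ζ⟩

theorem integrable_mul_schwartz {m : PhaseSpace d → ℂ} (hm : Integrable m)
    (b : 𝓢(PhaseSpace d, ℂ)) : Integrable fun ζ => m ζ * b ζ := by
  obtain ⟨C, hC⟩ := b.exists_norm_le
  exact hm.mul_bdd b.continuous.aestronglyMeasurable (Filter.Eventually.of_forall hC)

theorem phaseConv_sub_schwartz {f g : PhaseSpace d → ℂ} (hf : Integrable f) (hg : Integrable g)
    (a : 𝓢(PhaseSpace d, ℂ)) (z : PhaseSpace d) :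
    phaseConv a (fun w => f w - g w) z = phaseConv a f z - phaseConv a g z := by
  obtain ⟨C, hC⟩ := a.exists_norm_le
  have hi : ∀ {f : PhaseSpace d → ℂ}, Integrable f → Integrable fun w => f w * a (z - w) :=
    fun hf => hf.mul_bdd (a.continuous.comp (by fun_prop)).aestronglyMeasurable
      (Filter.Eventually.of_forall fun w => hC _)
  rw [phaseConv_comm, phaseConv_comm a f, phaseConv_comm a g, phaseConv, phaseConv, phaseConv,
    ← integral_sub (hi hf) (hi hg)]
  simp only [sub_mul]

theorem exists_schwartz_tendsto {f : PhaseSpace d → ℂ} (hf : Integrable f) :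
    ∃ F : ℕ → 𝓢(PhaseSpace d, ℂ), Filter.Tendsto (fun n => eLpNorm (fun w => F n w - f w) 1 volume)
      Filter.atTop (nhds 0) := by
  have hd := SchwartzMap.denseRange_toLpCLM (E := PhaseSpace d) (F := ℂ) (p := 1)
    ENNReal.one_ne_top (μ := volume)
  obtain ⟨u, hu, hlim⟩ := mem_closure_iff_seq_limit.1
    (hd ((memLp_one_iff_integrable.2 hf).toLp f))
  choose F hF using hu
  refine ⟨F, ?_⟩
  rw [tendsto_iff_edist_tendsto_0] at hlim
  refine hlim.congr fun n => ?_
  rw [Lp.edist_def, ← hF n]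
  refine eLpNorm_congr_ae ?_
  filter_upwards [(F n).coeFn_toLp 1 volume, (memLp_one_iff_integrable.2 hf).coeFn_toLp]
    with z h1 h2
  rw [Pi.sub_apply, SchwartzMap.toLpCLM_apply, h1, h2]

/-- The extension is prescribed only on Schwartz functions, whereas `f` is merely integrable.
Approximating `f` in `L^1` makes the convolutions with the Schwartz function `a` converge in `L^p`
for every `p`, including `∞`, so boundedness of `A` determines its value here. -/
theorem ExtendsClassical.apply_phaseConv {p q : ℝ≥0∞} [Fact (1 ≤ p)] [Fact (1 ≤ q)]
    {m : PhaseSpace d → ℂ} {A : Lp ℂ p (volume : Measure (PhaseSpace d)) →L[ℂ]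
      Lp ℂ q (volume : Measure (PhaseSpace d))} (hA : ExtendsClassical p q m A)
    (hm : Integrable m) (b : 𝓢(PhaseSpace d, ℂ)) {f : PhaseSpace d → ℂ}
    (hf : StronglyMeasurable f) (hfi : Integrable f)
    (hL : MemLp (phaseConv (symplecticFourierSchwartz b) f) p volume) :
    A (hL.toLp _) =ᵐ[volume] symplecticFourier fun ζ => m ζ * b ζ * symplecticFourier f ζ := by
  set a := symplecticFourierSchwartz b with ha
  obtain ⟨F, hF⟩ := exists_schwartz_tendsto hfi
  -- Convolution of `a = ℱ_σ(b)` with a Schwartz function `g` is `ℱ_σ(b · ℱ_σ(g))`, hence again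
  -- Schwartz.
  have hconv : ∀ g : 𝓢(PhaseSpace d, ℂ), ∃ Ψ : 𝓢(PhaseSpace d, ℂ), ⇑Ψ = phaseConv a g ∧
      ∀ ζ, symplecticFourier Ψ ζ = b ζ * symplecticFourier g ζ := fun g => by
    set h := SchwartzMap.pairing (ContinuousLinearMap.mul ℂ ℂ) b (symplecticFourierSchwartz g)
    have hh : ∀ ζ, h ζ = b ζ * symplecticFourier g ζ := fun ζ => by
      rw [← coe_symplecticFourierSchwartz]
      rfl
    refine ⟨symplecticFourierSchwartz h, ?_, fun ζ => ?_⟩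
    · funext z
      rw [phaseConv_comm, ha, coe_symplecticFourierSchwartz, coe_symplecticFourierSchwartz,
        phaseConv_symplecticFourier g.integrable b.integrable, symplecticFourier_apply]
      simp only [hh]
    · rw [coe_symplecticFourierSchwartz, symplecticFourier_symplecticFourier, hh]
  choose Ψ hΨ hΨF using fun n => hconv (F n)
  have hsm : ∀ n, StronglyMeasurable fun w => F n w - f w := fun n =>
    (F n).continuous.stronglyMeasurable.sub hf
  have hsi : ∀ n, Integrable fun w => F n w - f w := fun n => (F n).integrable.sub hfi
  have hlim : Filter.Tendsto (fun n => (Ψ n).toLp p volume) Filter.atTop (nhds (hL.toLp _)) := by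
    rw [tendsto_iff_edist_tendsto_0]
    -- Young's inequality with the `L^1` factor being the error `F n - f` and the `L^p` factor being
    -- `a`.
    have h1 : ∀ n, edist ((Ψ n).toLp p volume) (hL.toLp _) ≤
        eLpNorm (fun w => F n w - f w) 1 volume * eLpNorm a p volume := fun n => by
      rw [Lp.edist_def]
      refine le_trans (le_of_eq (eLpNorm_congr_ae ?_)) (eLpNorm_phaseConv_le Fact.out (hsm n)
        (hsi n) a.continuous.stronglyMeasurable)
      filter_upwards [(Ψ n).coeFn_toLp p volume, hL.coeFn_toLp] with z h1 h2
      rw [Pi.sub_apply, h1, h2, phaseConv_comm (fun w => F n w - f w) a,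
        phaseConv_sub_schwartz (F n).integrable hfi, hΨ n]
    refine tendsto_of_tendsto_of_tendsto_of_le_of_le tendsto_const_nhds ?_ (fun n => zero_le) h1
    simpa using ENNReal.Tendsto.mul_const hF (Or.inr (a.eLpNorm_lt_top p volume).ne)
  have hAlim := (A.continuous.tendsto _).comp hlim
  obtain ⟨ns, hns, hae⟩ := (tendstoInMeasure_of_tendsto_Lp hAlim).exists_seq_tendsto_ae
  have hmb := integrable_mul_schwartz hm b
  -- The same sequence converges at every point, because `ℱ_σ(F n)` converges uniformly and `m b` is
  -- integrable. Comparison with an almost everywhere convergent subsequence of the `L^q` limit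
  -- identifies the two.
  have hpt : ∀ z, Filter.Tendsto (fun n => classicalMultiplierOp m (Ψ n) z) Filter.atTop
      (nhds (symplecticFourier (fun ζ => m ζ * b ζ * symplecticFourier f ζ) z)) := fun z => by
    rw [tendsto_iff_norm_sub_tendsto_zero]
    have h1 : ∀ n, ‖classicalMultiplierOp m (Ψ n) z -
        symplecticFourier (fun ζ => m ζ * b ζ * symplecticFourier f ζ) z‖ ≤
        (∫ ζ, ‖m ζ * b ζ‖) * ∫ w, ‖F n w - f w‖ := fun n => by
      have e1 : classicalMultiplierOp m (Ψ n) z =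
          symplecticFourier (fun ζ => m ζ * b ζ * symplecticFourier (F n) ζ) z := by
        rw [classicalMultiplierOp, symplecticFourier_apply]
        congr 1 with ζ
        change m ζ * symplecticFourier (Ψ n) ζ * symplecticChar z ζ =
          m ζ * b ζ * symplecticFourier (F n) ζ * symplecticChar z ζ
        rw [hΨF]
        ring
      rw [e1, ← symplecticFourier_sub (integrable_mul_symplecticFourier hmb (F n).integrable)
        (integrable_mul_symplecticFourier hmb hfi)]
      refine (norm_symplecticFourier_le _ _).trans ?_
      rw [← integral_mul_const]
      refine integral_mono_of_nonneg (Filter.Eventually.of_forall fun ζ => norm_nonneg _)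
        (hmb.norm.mul_const _) (Filter.Eventually.of_forall fun ζ => ?_)
      simp only
      rw [← mul_sub, ← symplecticFourier_sub (F n).integrable hfi, norm_mul]
      gcongr
      exact norm_symplecticFourier_le _ _
    have h2 : ∀ n, ∫ w, ‖F n w - f w‖ = (eLpNorm (fun w => F n w - f w) 1 volume).toReal :=
      fun n => by
        rw [integral_norm_eq_lintegral_enorm (hsi n).1, eLpNorm_one_eq_lintegral_enorm]
    refine squeeze_zero (fun n => norm_nonneg _) h1 ?_
    simp only [h2]
    have h3 := (ENNReal.tendsto_toReal ENNReal.zero_ne_top).comp hF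
    simpa using h3.const_mul (∫ ζ, ‖m ζ * b ζ‖)
  have hall : ∀ᵐ z, ∀ n, A ((Ψ n).toLp p volume) z = classicalMultiplierOp m (Ψ n) z :=
    ae_all_iff.2 fun n => hA (Ψ n)
  filter_upwards [hae, hall] with z h1 h2
  refine tendsto_nhds_unique h1 ?_
  have h3 := (hpt z).comp hns.tendsto_atTop
  refine h3.congr fun n => ?_
  exact (h2 (ns n)).symm

theorem stronglyMeasurable_phaseConv_lowerSymbol (a : 𝓢(PhaseSpace d, ℂ))
    (T : L2Space d →L[ℂ] L2Space d) :
    StronglyMeasurable (phaseConv a (lowerSymbol coherentState T)) :=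
  stronglyMeasurable_phaseConv a.continuous.stronglyMeasurable
    (isCoherentFamily_coherentState.stronglyMeasurable_lowerSymbol T)

theorem eLpNorm_phaseConv_lowerSymbol_le {p : ℝ≥0∞} (hp : 1 ≤ p) (a : 𝓢(PhaseSpace d, ℂ))
    (T : L2Space d →L[ℂ] L2Space d) :
    eLpNorm (phaseConv a (lowerSymbol coherentState T)) p volume ≤
      eLpNorm a 1 volume * schattenNorm p T := by
  refine (eLpNorm_phaseConv_le hp a.continuous.stronglyMeasurable a.integrable
    (isCoherentFamily_coherentState.stronglyMeasurable_lowerSymbol T)).trans ?_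
  gcongr
  exact isCoherentFamily_coherentState.eLpNorm_lowerSymbol_le hp T

theorem memLp_phaseConv_lowerSymbol {p : ℝ≥0∞} (hp : 1 ≤ p) (a : 𝓢(PhaseSpace d, ℂ))
    (T : schattenClass (L2Space d) p) :
    MemLp (phaseConv a (lowerSymbol coherentState (T : L2Space d →L[ℂ] L2Space d))) p volume :=
  ⟨(stronglyMeasurable_phaseConv_lowerSymbol a _).aestronglyMeasurable,
    (eLpNorm_phaseConv_lowerSymbol_le hp a _).trans_lt
      (ENNReal.mul_lt_top (a.eLpNorm_lt_top 1 volume) T.2)⟩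

theorem integrable_schwartz_mul_lowerSymbol (a : 𝓢(PhaseSpace d, ℂ))
    (T : L2Space d →L[ℂ] L2Space d) (z : PhaseSpace d) :
    Integrable fun w => a w * lowerSymbol coherentState T (z - w) :=
  a.integrable.mul_bdd ((isCoherentFamily_coherentState.stronglyMeasurable_lowerSymbol
    T).comp_measurable (measurable_const.sub measurable_id)).aestronglyMeasurable
    (Filter.Eventually.of_forall fun _ => isCoherentFamily_coherentState.norm_lowerSymbol_le T _)

/-- The smoothed lower symbol `T ↦ a * ⟨φ_z, T φ_z⟩` as a linear map `𝒮^p → L^p`. -/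
noncomputable def smoothedSymbolₗ (a : 𝓢(PhaseSpace d, ℂ)) (p : ℝ≥0∞) [Fact (1 ≤ p)] :
    schattenClass (L2Space d) p →ₗ[ℂ] Lp ℂ p (volume : Measure (PhaseSpace d)) where
  toFun T := (memLp_phaseConv_lowerSymbol Fact.out a T).toLp _
  map_add' S T := by
    rw [← MemLp.toLp_add, MemLp.toLp_eq_toLp_iff]
    refine Filter.Eventually.of_forall fun z => ?_
    rw [Pi.add_apply, phaseConv, phaseConv, phaseConv,
      ← integral_add (integrable_schwartz_mul_lowerSymbol a _ z)
        (integrable_schwartz_mul_lowerSymbol a _ z)]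
    congr 1 with w
    simp only [lowerSymbol, Submodule.coe_add, add_apply, inner_add_right]
    ring
  map_smul' c T := by
    rw [RingHom.id_apply, ← MemLp.toLp_const_smul, MemLp.toLp_eq_toLp_iff]
    refine Filter.Eventually.of_forall fun z => ?_
    rw [Pi.smul_apply, smul_eq_mul, phaseConv, phaseConv, ← integral_const_mul]
    congr 1 with w
    simp only [lowerSymbol, Submodule.coe_smul, smul_apply, inner_smul_right]
    ring

theorem enorm_smoothedSymbolₗ_le (a : 𝓢(PhaseSpace d, ℂ)) {p : ℝ≥0∞} [Fact (1 ≤ p)]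
    (T : schattenClass (L2Space d) p) :
    ‖smoothedSymbolₗ a p T‖ₑ ≤
      eLpNorm a 1 volume * schattenNorm p (T : L2Space d →L[ℂ] L2Space d) := by
  rw [smoothedSymbolₗ, LinearMap.coe_mk, AddHom.coe_mk, Lp.enorm_toLp]
  exact eLpNorm_phaseConv_lowerSymbol_le Fact.out a _

variable {Ω : Set (PhaseSpace d)} {m : PhaseSpace d → ℂ} {b : 𝓢(PhaseSpace d, ℂ)}

/-- The extension is localization ∘ `A` ∘ smoothed lower symbol. Its symbol is `m b G²`: one factor
`G` comes from each outer map and `b` from the smoothing. -/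
theorem exists_extendsFourierWigner (hb : ∀ ζ ∈ Ω, b ζ * (gaussianAmbiguity ζ : ℂ) ^ 2 = 1)
    (hm : Integrable m) (h0 : ∀ᵐ z, z ∉ Ω → m z = 0) {p q : ℝ≥0∞} [Fact (1 ≤ p)] [Fact (1 ≤ q)]
    {A : Lp ℂ p (volume : Measure (PhaseSpace d)) →L[ℂ]
      Lp ℂ q (volume : Measure (PhaseSpace d))} (hA : ExtendsClassical p q m A) :
    ∃ A' : schattenClass (L2Space d) p →ₗ[ℂ] schattenClass (L2Space d) q,
      ExtendsFourierWigner p q m A' ∧ ∀ T : schattenClass (L2Space d) p,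
        schattenNorm q (A' T : L2Space d →L[ℂ] L2Space d) ≤
          4 * eLpNorm (symplecticFourierSchwartz b) 1 volume * ‖A‖ₑ *
            schattenNorm p (T : L2Space d →L[ℂ] L2Space d) := by
  set a := symplecticFourierSchwartz b
  refine ⟨isCoherentFamily_coherentState.localizationOpₗ ∘ₗ (A : _ →ₗ[ℂ] _) ∘ₗ
    smoothedSymbolₗ a p, fun T hT => ?_, fun T => ?_⟩
  · have hfi := integrable_lowerSymbol hT
    have h1 := hA.apply_phaseConv hm b
      (isCoherentFamily_coherentState.stronglyMeasurable_lowerSymbol _) hfi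
      (memLp_phaseConv_lowerSymbol Fact.out a T)
    refine (isWeakShiftIntegral_localizationOp (integrable_mul_symplecticFourier
      (integrable_mul_schwartz hm b) hfi) h1).congr_ae ?_
    filter_upwards [h0] with ζ hζ
    rw [symplecticFourier_lowerSymbol hT]
    by_cases hζΩ : ζ ∈ Ω
    · linear_combination (m ζ * fourierWigner (T : L2Space d →L[ℂ] L2Space d) ζ) * hb ζ hζΩ
    · rw [hζ hζΩ]
      ring
  · calc schattenNorm q (isCoherentFamily_coherentState.localizationOp (A (smoothedSymbolₗ a p T)))
        ≤ 4 * ‖A (smoothedSymbolₗ a p T)‖ₑ :=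
          isCoherentFamily_coherentState.schattenNorm_localizationOp_le _
      _ ≤ 4 * (‖A‖ₑ * (eLpNorm a 1 volume * schattenNorm p (T : L2Space d →L[ℂ] L2Space d))) := by
          gcongr
          exact (A.le_opENorm _).trans (by gcongr; exact enorm_smoothedSymbolₗ_le a T)
      _ = _ := by ring

/-- The mirror image: smoothed lower symbol ∘ `A` ∘ localization, again with symbol `m b G² = m`. -/
theorem exists_extendsClassical (hb : ∀ ζ ∈ Ω, b ζ * (gaussianAmbiguity ζ : ℂ) ^ 2 = 1)
    (hm : Integrable m) (h0 : ∀ᵐ z, z ∉ Ω → m z = 0) {p q : ℝ≥0∞} [Fact (1 ≤ p)] [Fact (1 ≤ q)]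
    {A : schattenClass (L2Space d) p →ₗ[ℂ] schattenClass (L2Space d) q}
    (hA : ExtendsFourierWigner p q m A) {K : ℝ≥0} (hK : IsSchattenBound A K) :
    ∃ A' : Lp ℂ p (volume : Measure (PhaseSpace d)) →L[ℂ]
      Lp ℂ q (volume : Measure (PhaseSpace d)), ExtendsClassical p q m A' ∧
        ‖A'‖ₑ ≤ 4 * eLpNorm (symplecticFourierSchwartz b) 1 volume * K := by
  set a := symplecticFourierSchwartz b with ha
  set L := smoothedSymbolₗ a q ∘ₗ A ∘ₗ isCoherentFamily_coherentState.localizationOpₗ with hL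
  have hbound : ∀ F, ‖L F‖ₑ ≤ 4 * eLpNorm a 1 volume * K * ‖F‖ₑ := fun F => by
    calc ‖L F‖ₑ ≤ eLpNorm a 1 volume * (K * (4 * ‖F‖ₑ)) := by
          refine (enorm_smoothedSymbolₗ_le a _).trans ?_
          gcongr
          refine (hK _).trans ?_
          gcongr
          exact isCoherentFamily_coherentState.schattenNorm_localizationOp_le F
      _ = _ := by ring
  have hat : 4 * eLpNorm a 1 volume * K ≠ ∞ :=
    ENNReal.mul_ne_top (ENNReal.mul_ne_top (by simp) (a.eLpNorm_lt_top 1 volume).ne) (by simp)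
  have hbound' : ∀ F, ‖L F‖ ≤ (4 * eLpNorm a 1 volume * K).toReal * ‖F‖ := fun F => by
    have h := ENNReal.toReal_mono (ENNReal.mul_ne_top hat enorm_ne_top) (hbound F)
    rwa [ENNReal.toReal_mul, toReal_enorm, toReal_enorm] at h
  refine ⟨L.mkContinuous _ hbound', fun Ψ => ?_, ?_⟩
  · set F := Ψ.toLp p volume with hF
    have hFΨ : F =ᵐ[volume] Ψ := Ψ.coeFn_toLp p volume
    have hFi : Integrable F volume := Ψ.integrable.congr hFΨ.symm
    set T := isCoherentFamily_coherentState.localizationOp F with hT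
    -- The localization operator depends only on the function, not on the exponent of its `L^p`
    -- space. Regarding `Ψ` in `L^1` shows that `T` is trace class, where the action of `A` is
    -- prescribed.
    have hT1 : T = isCoherentFamily_coherentState.localizationOp (Ψ.toLp 1 volume) := by
      refine ContinuousLinearMap.ext fun f => ext_inner_left ℂ fun g => ?_
      rw [hT, isCoherentFamily_coherentState.inner_localizationOp,
        isCoherentFamily_coherentState.inner_localizationOp]
      refine integral_congr_ae ?_
      filter_upwards [hFΨ, Ψ.coeFn_toLp 1 volume] with z h1 h2
      rw [h1, h2]
    have hmem : T ∈ schattenClass (L2Space d) 1 := by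
      rw [hT1]
      exact (isCoherentFamily_coherentState.localizationOpₗ (Ψ.toLp 1 volume)).2
    have hw := hA (isCoherentFamily_coherentState.localizationOpₗ F) hmem
    have hFF : symplecticFourier F = symplecticFourier Ψ := by
      funext ζ
      refine integral_congr_ae ?_
      filter_upwards [hFΨ] with z hz
      rw [hz]
    have hls : lowerSymbol coherentState
        (A (isCoherentFamily_coherentState.localizationOpₗ F) : L2Space d →L[ℂ] L2Space d) =
          symplecticFourier fun ζ => m ζ * fourierWigner T ζ * (gaussianAmbiguity ζ : ℂ) :=
      lowerSymbol_eq_symplecticFourier hw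
    have hk : Integrable fun ζ : PhaseSpace d =>
        m ζ * fourierWigner T ζ * (gaussianAmbiguity ζ : ℂ) := by
      have h1 := (integrable_mul_symplecticFourier hm Ψ.integrable).mul_bdd (c := 1)
        (g := fun ζ => ((gaussianAmbiguity ζ : ℂ)) ^ 2)
        ((Complex.continuous_ofReal.comp contDiff_gaussianAmbiguity.continuous).pow
          2).aestronglyMeasurable
        (Filter.Eventually.of_forall fun ζ => by
          rw [norm_pow, Complex.norm_real, Real.norm_of_nonneg (gaussianAmbiguity_pos ζ).le]
          exact pow_le_one₀ (gaussianAmbiguity_pos ζ).le (gaussianAmbiguity_le_one ζ))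
      refine h1.congr (Filter.Eventually.of_forall fun ζ => ?_)
      simp only
      rw [fourierWigner_localizationOp F hFi, hFF]
      ring
    refine ((memLp_phaseConv_lowerSymbol Fact.out a _).coeFn_toLp).trans
      (Filter.Eventually.of_forall fun z => ?_)
    change phaseConv a (lowerSymbol coherentState
      (A (isCoherentFamily_coherentState.localizationOpₗ F) : L2Space d →L[ℂ] L2Space d)) z =
        classicalMultiplierOp m Ψ z
    rw [hls, phaseConv_symplecticFourier a.integrable hk, classicalMultiplierOp]
    refine integral_congr_ae ?_
    filter_upwards [h0] with ζ hζ
    change m ζ * fourierWigner T ζ * (gaussianAmbiguity ζ : ℂ) * symplecticFourier a ζ *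
      symplecticChar z ζ = m ζ * symplecticFourier Ψ ζ * symplecticChar z ζ
    rw [fourierWigner_localizationOp F hFi, hFF, ha, coe_symplecticFourierSchwartz,
      symplecticFourier_symplecticFourier]
    by_cases hζΩ : ζ ∈ Ω
    · linear_combination (m ζ * symplecticFourier Ψ ζ * symplecticChar z ζ) * hb ζ hζΩ
    · rw [hζ hζΩ]
      ring
  · rw [← ofReal_norm]
    exact (ENNReal.ofReal_le_ofReal (L.mkContinuous_norm_le ENNReal.toReal_nonneg hbound')).trans
      (ENNReal.ofReal_toReal hat).le

end Transference

/-! ### The equivalence and the comparison of norms. -/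

theorem theorem1p1 (d : ℕ) (Ω : Set (PhaseSpace d)) (hΩ : IsCompact Ω) :
    ∃ C : ℝ≥0, 1 ≤ C ∧
      ∀ m : PhaseSpace d → ℂ, MemLp m ∞ volume → (∀ᵐ z, z ∉ Ω → m z = 0) →
        ∀ (p q : ℝ≥0∞) [Fact (1 ≤ p)] [Fact (1 ≤ q)],
          (IsClassicalMultiplier p q m ↔ IsFourierWignerMultiplier p q m) ∧
          fourierWignerMultiplierNorm p q m ≤ C * classicalMultiplierNorm p q m ∧
          classicalMultiplierNorm p q m ≤ C * fourierWignerMultiplierNorm p q m := by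
  obtain ⟨b, hb⟩ := exists_schwartz_mul_gaussianAmbiguity_sq_eq_one hΩ
  set N : ℝ≥0 := (4 * eLpNorm (symplecticFourierSchwartz b) 1 volume).toNNReal
  have hN : (N : ℝ≥0∞) = 4 * eLpNorm (symplecticFourierSchwartz b) 1 volume :=
    ENNReal.coe_toNNReal (ENNReal.mul_ne_top (by simp)
      ((symplecticFourierSchwartz b).eLpNorm_lt_top 1 volume).ne)
  have hNC : (N : ℝ≥0∞) ≤ (max 1 N : ℝ≥0) := ENNReal.coe_le_coe.2 (le_max_right _ _)
  -- A nonzero constant is needed to move it inside the infimum, which is `∞` when no extension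
  -- exists.
  have hC0 : ((max 1 N : ℝ≥0) : ℝ≥0∞) ≠ 0 :=
    ENNReal.coe_ne_zero.2 (one_pos.trans_le (le_max_left _ _)).ne'
  refine ⟨max 1 N, le_max_left _ _, fun m hm h0 p q _ _ => ?_⟩
  have hmi := integrable_of_memLp_top_of_ae_eq_zero hΩ hm h0
  have to_wigner : ∀ A : Lp ℂ p (volume : Measure (PhaseSpace d)) →L[ℂ]
      Lp ℂ q (volume : Measure (PhaseSpace d)), ExtendsClassical p q m A →
      ∃ A' : schattenClass (L2Space d) p →ₗ[ℂ] schattenClass (L2Space d) q,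
        ExtendsFourierWigner p q m A' ∧ IsSchattenBound A' (N * ‖A‖₊) := fun A hA => by
    obtain ⟨A', hA', hbd⟩ := exists_extendsFourierWigner hb hmi h0 hA
    refine ⟨A', hA', fun T => (hbd T).trans (le_of_eq ?_)⟩
    rw [← hN, ENNReal.coe_mul, enorm_eq_nnnorm]
  refine ⟨⟨fun ⟨_, A, hA⟩ => ?_, fun ⟨_, A, hA, K, hK⟩ => ?_⟩, ?_, ?_⟩
  · obtain ⟨A', hA', hbd⟩ := to_wigner A hA
    exact ⟨hm, A', hA', _, hbd⟩
  · obtain ⟨A', hA', -⟩ := exists_extendsClassical hb hmi h0 hA hK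
    exact ⟨hm, A', hA'⟩
  · simp only [classicalMultiplierNorm, ENNReal.mul_iInf_of_ne hC0 ENNReal.coe_ne_top]
    -- Every extension is transferred separately, so uniqueness of extensions plays no role and `p =
    -- ∞` is included.
    refine le_iInf₂ fun A hA => ?_
    obtain ⟨A', hA', hbd⟩ := to_wigner A hA
    refine (iInf_le_of_le A' (iInf₂_le _ ⟨hA', hbd⟩)).trans ?_
    rw [ENNReal.coe_mul, enorm_eq_nnnorm]
    gcongr
  · simp only [fourierWignerMultiplierNorm, ENNReal.mul_iInf_of_ne hC0 ENNReal.coe_ne_top]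
    refine le_iInf fun A => le_iInf₂ fun K hAK => ?_
    obtain ⟨A', hA', hbd⟩ := exists_extendsClassical hb hmi h0 hAK.1 hAK.2
    refine (iInf₂_le A' hA').trans (hbd.trans ?_)
    rw [← hN]
    gcongr
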